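/- Fix a dimension $m\ge 1$, a norm $\|\cdot\|_q$ on $\mathbb R^m$ with $1\le q\le\infty$, a link probability $p\in(0,1]$ and constants $A_1,A_2>0$ with $pA_1<1$ and $pA_1\ne 1/2$. Let $S=[0,1]^m$ carry the torus metric $d(x,y)=\min\{\|x-y+u\|_q : u\in\{-1,0,1\}^m\}$, and let $c_m$ be the volume of the unit ball of $\|\cdot\|_q$ in $\mathbb R^m$. The SPA model produces random directed graphs $G_0,G_1,G_2,\dots$, where $G_0$ is empty. At each time-step $t\ge1$ a new vertex $v_t$ is placed uniformly at random in $S$, independently of the past. Then, independently for each older vertex $u\in\{v_1,\dots,v_{t-1}\}$ with $v_t\in S(u,t-1)$, the directed edge $(v_t,u)$ is added with probability $p$. Here, for $t\ge 1$, $S(u,t)$ is the ball in $(S,d)$ centred at $u$ of volume $(A_1\deg^-(u,t)+A_2)/t$ (and $S(u,t)=S$ if this number exceeds $1$), where $\deg^-(u,t)$ is the in-degree of $u$ in $G_t$. For $\alpha\ge 0$ and $n\ge1$ let $e(\alpha)=e_n(\alpha)$ be the number of edges $(v,w)$ of $G_n$ with $d(v,w)\ge r_\alpha:=(n^{-\alpha}/c_m)^{1/m}$.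 **Theorem.** Let $\alpha\ge0$ be fixed; if $\alpha=0$, assume in addition that $\mathbb E(e_n(0))>0$ for some $n$. Then $\mathbb E(e(\alpha))>0$ for all sufficiently large $n$, and the following holds as $n\to\infty$. If $1/2<pA_1<1$, then $$\frac{\log\mathbb E(e(\alpha))}{\log n}=\begin{cases}1+o(1) & \text{if }\alpha\ge1,\\ 2-\frac1{pA_1}+\alpha\frac{1-pA_1}{pA_1}+o(1) & \text{if }1-pA_1<\alpha<1,\\ \frac{\alpha pA_1}{1-pA_1}+o(1) & \text{if }0\le\alpha\le1-pA_1.\end{cases}$$ If $pA_1<1/2$, then $$\frac{\log\mathbb E(e(\alpha))}{\log n}=\begin{cases}1+o(1) & \text{if }\alpha\ge1,\\ \alpha+o(1) & \text{if }0\le\alpha<1.\end{cases}$$ -/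

import Mathlib

open MeasureTheory Filter Topology
open scoped ENNReal unitInterval

namespace SPA

noncomputable section

/-- The unit hypercube of dimension `m`. Its `volume` is Lebesgue measure on it, i.e. the uniform
distribution. -/
abbrev Cube (m : ℕ) : Type := Fin m → I

/-- The torus metric on the unit hypercube derived from the `L_q` norm:
`d(x, y) = min {‖x - y + u‖_q : u ∈ {-1, 0, 1}^m}` (`SignType` is `{-1, 0, 1}`; the infimum runs
over a finite nonempty set, so it is a minimum). -/
def torusDist {m : ℕ} (q : ℝ≥0∞) (x y : Cube m) : ℝ :=
  ⨅ u : Fin m → SignType, ‖WithLp.toLp q (fun i => (x i : ℝ) - (y i : ℝ) + (u i : ℝ))‖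

/-- The ball of radius `r` around `x` in the torus metric. -/
def torusBall {m : ℕ} (q : ℝ≥0∞) (x : Cube m) (r : ℝ) : Set (Cube m) :=
  {y | torusDist q x y ≤ r}

/-- The constant `c_m`: the volume of the unit ball of the `L_q` norm on `ℝ^m`. -/
def unitBallVolume (m : ℕ) (q : ℝ≥0∞) : ℝ :=
  volume.real {x : Fin m → ℝ | ‖WithLp.toLp q x‖ ≤ 1}

/-- The radius of the ball around `x` whose volume is `V` (for `0 ≤ V ≤ 1`). The volume of a ball
depends continuously on its radius, so the infimum is attained and the ball has volume exactly
`V`. -/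
def radiusOfVolume {m : ℕ} (q : ℝ≥0∞) (x : Cube m) (V : ℝ) : ℝ :=
  sInf {r : ℝ | 0 ≤ r ∧ V ≤ volume.real (torusBall q x r)}

open Classical in
/-- The region of influence with nominal volume `V` around `x`: the ball around `x` of
volume `V`, or the whole space if `V` is greater than `1`. -/
def influence {m : ℕ} (q : ℝ≥0∞) (x : Cube m) (V : ℝ) : Set (Cube m) :=
  if 1 < V then Set.univ else torusBall q x (radiusOfVolume q x V)

/-- The randomness of the process. For `ω : Outcome m` and a time-step `t ≥ 1`, `(ω t).1` is the
position of the new vertex `v_t`, and `(ω t).2 s` is the uniform variable deciding whether `v_t`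
links to the older vertex `v_s`, in case it may. -/
abbrev Outcome (m : ℕ) : Type := ℕ → Cube m × (ℕ → I)

/-- All positions are uniform on the hypercube, all link variables are uniform on `[0, 1]`, and
everything is independent. -/
def law (m : ℕ) : Measure (Outcome m) :=
  Measure.infinitePi fun _ : ℕ =>
    (volume : Measure (Cube m)).prod (Measure.infinitePi fun _ : ℕ => (volume : Measure I))

instance (m : ℕ) : IsProbabilityMeasure (law m) := by
  unfold law; infer_instance

/-- The in-degree of the vertex `v_s` when the set of directed edges is `E`; the pair `(t, s)`
stands for the edge `(v_t, v_s)` from `v_t` to `v_s`. -/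
def inDegree (E : Finset (ℕ × ℕ)) (s : ℕ) : ℕ :=
  (E.filter fun e => e.2 = s).card

open Classical in
/-- The edge set of the graph `G_t`, whose vertices are `v_1, …, v_t`. In time-step `t + 1` the
vertex `v_{t+1}` is added, and it links, with probability `p` and independently, to each
`v_s`, `1 ≤ s ≤ t`, whose sphere of influence `S(v_s, t)` contains it. That sphere has
volume `(A₁ deg⁻(v_s, t) + A₂) / t`. -/
def edges {m : ℕ} (q : ℝ≥0∞) (p A₁ A₂ : ℝ) (ω : Outcome m) : ℕ → Finset (ℕ × ℕ)
  | 0 => ∅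
  | t + 1 =>
      edges q p A₁ A₂ ω t ∪
        ((Finset.Icc 1 t).filter fun s =>
          (ω (t + 1)).1 ∈ influence q (ω s).1
              ((A₁ * (inDegree (edges q p A₁ A₂ ω t) s : ℝ) + A₂) / (t : ℝ)) ∧
            ((ω (t + 1)).2 s : ℝ) ≤ p).image fun s => (t + 1, s)

/-- The threshold `r_α = (n^{-α} / c_m)^{1/m}`. -/
def longThreshold (m : ℕ) (q : ℝ≥0∞) (α : ℝ) (n : ℕ) : ℝ :=
  ((n : ℝ) ^ (-α) / unitBallVolume m q) ^ (1 / (m : ℝ))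

open Classical in
/-- The number `e(α)` of long edges of `G_n`, those of length at least `r_α`. -/
def longEdges {m : ℕ} (q : ℝ≥0∞) (p A₁ A₂ α : ℝ) (n : ℕ) (ω : Outcome m) : ℕ :=
  ((edges q p A₁ A₂ ω n).filter fun e =>
    longThreshold m q α n ≤ torusDist q (ω e.1).1 (ω e.2).1).card

/-- The expected number `𝔼(e(α))` of long edges of `G_n`. -/
def expectedLongEdges (m : ℕ) (q : ℝ≥0∞) (p A₁ A₂ α : ℝ) (n : ℕ) : ℝ :=
  ∫ ω, (longEdges q p A₁ A₂ α n ω : ℝ) ∂(law m)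

end

end SPA

/-! Write a = pA₁, let V(s,t) be the nominal volume of the sphere of influence of v_s at time t, and
let w(s,t) = (t/s)^a / t be its typical order (`typicalVolume`). By linearity, 𝔼(e(α)) is the sum
over pairs s ≤ t of the probability that v_{t+1} links to v_s over distance at least r_α, and a ball
of radius r_α has volume of order n^{-α}, uniformly in its centre. So only spheres with V at least
of order n^{-α} can produce long edges.

The degree process enters only through moments: 𝔼 V^k ≤ C w^k for every k
(`exists_integral_nominalVolume_pow_le`), because rising factorials of the shifted degree turn the
one-step recursion into a scalar one; and 𝔼 V ≥ c w once s is large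
(`exists_le_integral_nominalVolume`), because truncating V at 1 costs at most V², whose total effect
is small.

Upper bounds. A Markov-type argument gives a link probability of at most C w (w n^α)^k, and
interpolation in k gives C w^{1+θ} n^{αθ} for every real θ ≥ 0 (`exists_law_linkEvent_le_rpow`).
Summing over s and t leaves power sums in which θ is free: θ = 0 gives n; θ = 1 gives n^α if a <
1/2; if a > 1/2, θ = (1-a)/a and θ = a/(1-a) give the middle and the small range of α. Each value
makes the bound sharp up to a logarithm in its regime.

Lower bounds. The long-link probability is at least the total link probability minus C n^{-α}, the
cost of landing within r_α. It therefore suffices to count pairs (s,t) for which w, or simply A₂/t,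
exceeds a large multiple of n^{-α}: all pairs with t ≤ εn^γ, or old vertices s ≤ εn^δ at times t ≥
n/2, or one fixed vertex up to time εn^τ. Powers matching up to constants and a logarithm give the
limit of the log ratio (`tendsto_log_div_log`).

The value α = 0 needs its own hypothesis because r_0 may be as large as the diameter of the torus,
as for q = ∞. -/

namespace SPA

/-! ### Volumes of torus balls and spheres of influence -/

section Geometry

variable {m : ℕ} {q : ℝ≥0∞}

theorem torusDist_le (x y : Cube m) (u : Fin m → SignType) :
    torusDist q x y ≤ ‖WithLp.toLp q (fun i => (x i : ℝ) - (y i : ℝ) + (u i : ℝ))‖ :=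
  ciInf_le (Set.finite_range _).bddBelow u

theorem exists_torusDist_eq (x y : Cube m) : ∃ u : Fin m → SignType,
    torusDist q x y = ‖WithLp.toLp q (fun i => (x i : ℝ) - (y i : ℝ) + (u i : ℝ))‖ := by
  obtain ⟨u, hu⟩ := exists_eq_ciInf_of_finite
    (f := fun u : Fin m → SignType =>
      ‖WithLp.toLp q (fun i => (x i : ℝ) - (y i : ℝ) + (u i : ℝ))‖)
  exact ⟨u, hu.symm⟩

variable (q) in
/-- The volume of a torus ball. -/
noncomputable def ballVolume (x : Cube m) (r : ℝ) : ℝ := volume.real (torusBall q x r)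

theorem ballVolume_mono (x : Cube m) : Monotone (ballVolume q x) := fun _ _ h =>
  measureReal_mono fun _ hy => le_trans hy h

theorem ballVolume_le_one (x : Cube m) (r : ℝ) : ballVolume q x r ≤ 1 := measureReal_le_one

variable [Fact (1 ≤ q)]

theorem torusDist_nonneg (x y : Cube m) : 0 ≤ torusDist q x y := by
  obtain ⟨u, hu⟩ := exists_torusDist_eq (q := q) x y
  rw [hu]; exact norm_nonneg _

theorem torusDist_comm_le (x y : Cube m) : torusDist q x y ≤ torusDist q y x := by
  obtain ⟨u, hu⟩ := exists_torusDist_eq (q := q) y x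
  rw [hu, ← norm_neg, ← WithLp.toLp_neg]
  refine (torusDist_le x y (fun i => - u i)).trans (le_of_eq ?_)
  congr 2
  funext i
  simp only [Pi.neg_apply, SignType.coe_neg]
  ring

theorem torusDist_comm (x y : Cube m) : torusDist q x y = torusDist q y x :=
  le_antisymm (torusDist_comm_le x y) (torusDist_comm_le y x)

theorem measurable_torusDist : Measurable fun z : Cube m × Cube m => torusDist q z.1 z.2 := by
  unfold torusDist
  refine Measurable.iInf fun u => Continuous.measurable ?_
  refine continuous_norm.comp ((PiLp.continuous_toLp q _).comp ?_)
  fun_prop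

theorem measurable_torusDist_comp {Ω : Type*} [MeasurableSpace Ω] {f g : Ω → Cube m}
    (hf : Measurable f) (hg : Measurable g) : Measurable fun ω => torusDist q (f ω) (g ω) := by
  have h := (measurable_torusDist (m := m) (q := q)).comp (hf.prodMk hg)
  exact h

theorem measurable_torusDist_left (x : Cube m) : Measurable fun y : Cube m => torusDist q x y :=
  measurable_torusDist_comp measurable_const measurable_id

/-- Lebesgue measure transported to the normed space `PiLp q` is an additive Haar measure, and Haar
measures do not charge spheres. -/
theorem volume_norm_toLp_eq (hm : 0 < m) (r : ℝ) :
    volume {w : Fin m → ℝ | ‖WithLp.toLp q w‖ = r} = 0 := by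
  have : Nonempty (Fin m) := ⟨⟨0, hm⟩⟩
  set e := (PiLp.continuousLinearEquiv q ℝ (fun _ : Fin m => ℝ)).symm with he
  let _ : MeasurableSpace (PiLp q fun _ : Fin m => ℝ) := borel _
  have : BorelSpace (PiLp q fun _ : Fin m => ℝ) := ⟨rfl⟩
  have : (Measure.map e (volume : Measure (Fin m → ℝ))).IsAddHaarMeasure :=
    e.isAddHaarMeasure_map volume
  have h := Measure.addHaar_sphere (Measure.map e (volume : Measure (Fin m → ℝ))) 0 r
  rw [Measure.map_apply e.continuous.measurable Metric.isClosed_sphere.measurableSet] at h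
  convert h using 2
  ext w
  simp [he]

theorem map_coe_volume_le :
    Measure.map (fun (y : Cube m) (i : Fin m) => (y i : ℝ)) volume ≤ volume := by
  have h : Measure.map (fun (y : Cube m) (i : Fin m) => (y i : ℝ)) volume
      = (volume : Measure (Fin m → ℝ)).restrict (Set.univ.pi fun _ => I) := by
    rw [volume_pi, volume_pi, Measure.restrict_pi_pi,
      Measure.pi_map_pi (fun _ => measurable_subtype_coe.aemeasurable)]
    congr 1
    funext i
    exact (map_comap_subtype_coe measurableSet_Icc volume)
  rw [h]
  exact Measure.restrict_le_self

theorem measurable_coe_cube : Measurable (fun (y : Cube m) (i : Fin m) => (y i : ℝ)) := by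
  fun_prop

theorem volume_preimage_coe_le {S : Set (Fin m → ℝ)} (hS : MeasurableSet S) :
    volume {y : Cube m | (fun i => (y i : ℝ)) ∈ S} ≤ volume S := by
  have h := map_coe_volume_le (m := m) S
  rwa [Measure.map_apply measurable_coe_cube hS] at h

theorem measurable_norm_toLp : Measurable fun w : Fin m → ℝ => ‖WithLp.toLp q w‖ :=
  (continuous_norm.comp (PiLp.continuous_toLp q _)).measurable

theorem volume_sub_mem_le (v : Fin m → ℝ) {S : Set (Fin m → ℝ)} (hS : MeasurableSet S) :
    volume {y : Cube m | (fun i => v i - (y i : ℝ)) ∈ S} ≤ volume S := by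
  have h := volume_preimage_coe_le (m := m) (S := (fun w => v - w) ⁻¹' S)
    ((measurable_const.sub measurable_id) hS)
  exact h.trans_eq ((Measure.measurePreserving_sub_left volume v).measure_preimage hS.nullMeasurableSet)

/-- A torus sphere is covered by finitely many translates of norm spheres. This is what makes the
volume of a ball continuous in its radius. -/
theorem volume_torusDist_eq (hm : 0 < m) (x : Cube m) (r : ℝ) :
    volume {y : Cube m | torusDist q x y = r} = 0 := by
  refine measure_mono_null (t := ⋃ u : Fin m → SignType,
    {y : Cube m | (fun i => ((x i : ℝ) + (u i : ℝ)) - (y i : ℝ)) ∈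
      {w : Fin m → ℝ | ‖WithLp.toLp q w‖ = r}}) ?_ ?_
  · intro y hy
    obtain ⟨u, hu⟩ := exists_torusDist_eq (q := q) x y
    refine Set.mem_iUnion.2 ⟨u, ?_⟩
    simp only [Set.mem_ofPred_eq] at hy ⊢
    rw [← hy, hu]
    congr 2
    funext i
    ring
  · refine measure_iUnion_null fun u => ?_
    exact le_antisymm ((volume_sub_mem_le (fun i => (x i : ℝ) + (u i : ℝ))
      (measurable_norm_toLp (measurableSet_singleton r))).trans
        (volume_norm_toLp_eq hm r).le) bot_le

theorem ballVolume_eq_cdf (x : Cube m) :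
    ballVolume q x = ProbabilityTheory.cdf (Measure.map (torusDist q x) volume) := by
  have := Measure.isProbabilityMeasure_map (μ := (volume : Measure (Cube m)))
    (measurable_torusDist_left (q := q) x).aemeasurable
  funext r
  rw [ProbabilityTheory.cdf_eq_real, map_measureReal_apply (measurable_torusDist_left x)
    measurableSet_Iic]
  rfl

/-- As a function of the radius the ball volume is the distribution function of the distance to x,
and that distance has no atoms. -/
theorem continuous_ballVolume (hm : 0 < m) (x : Cube m) : Continuous (ballVolume q x) := by
  have := Measure.isProbabilityMeasure_map (μ := (volume : Measure (Cube m)))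
    (measurable_torusDist_left (q := q) x).aemeasurable
  rw [ballVolume_eq_cdf]
  set μ := Measure.map (torusDist q x) (volume : Measure (Cube m)) with hμ
  refine continuous_iff_continuousAt.2 fun r => ?_
  have hr : μ {r} = 0 := by
    rw [hμ, Measure.map_apply (measurable_torusDist_left x) (measurableSet_singleton r)]
    exact volume_torusDist_eq hm x r
  rw [← ProbabilityTheory.measure_cdf μ, StieltjesFunction.measure_singleton,
    ENNReal.ofReal_eq_zero] at hr
  rw [(ProbabilityTheory.cdf μ).mono.continuousAt_iff_leftLim_eq_rightLim,
    StieltjesFunction.rightLim_eq]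
  exact le_antisymm ((ProbabilityTheory.cdf μ).mono.leftLim_le le_rfl) (by linarith)

theorem ballVolume_zero (hm : 0 < m) (x : Cube m) : ballVolume q x 0 = 0 := by
  have h : torusBall q x 0 = {y : Cube m | torusDist q x y = 0} := by
    ext y
    exact ⟨fun h => le_antisymm h (torusDist_nonneg x y), fun h => le_of_eq h⟩
  rw [ballVolume, h, measureReal_def, volume_torusDist_eq hm x 0, ENNReal.toReal_zero]

theorem exists_norm_toLp_le (m : ℕ) (q : ℝ≥0∞) [Fact (1 ≤ q)] :
    ∃ C : ℝ, 1 ≤ C ∧ ∀ w : Fin m → ℝ, ‖WithLp.toLp q w‖ ≤ C * ‖w‖ := by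
  set e := (PiLp.continuousLinearEquiv q ℝ (fun _ : Fin m => ℝ)).symm with he
  refine ⟨max 1 ‖(e : (Fin m → ℝ) →L[ℝ] PiLp q fun _ : Fin m => ℝ)‖, le_max_left _ _, fun w => ?_⟩
  refine (ContinuousLinearMap.le_opNorm
    (e : (Fin m → ℝ) →L[ℝ] PiLp q fun _ : Fin m => ℝ) w).trans ?_
  gcongr
  exact le_max_right _ _

theorem norm_le_norm_toLp (w : Fin m → ℝ) : ‖w‖ ≤ ‖WithLp.toLp q w‖ :=
  (pi_norm_le_iff_of_nonneg (norm_nonneg _)).2 fun i =>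
    PiLp.norm_apply_le (p := q) (WithLp.toLp q w) i

theorem exists_ballVolume_eq_one (x : Cube m) : ∃ R : ℝ, 0 ≤ R ∧ ballVolume q x R = 1 := by
  obtain ⟨C, hC1, hC⟩ := exists_norm_toLp_le m q
  refine ⟨C * 1, by linarith, ?_⟩
  have h : torusBall q x (C * 1) = Set.univ := by
    refine Set.eq_univ_of_forall fun y => ?_
    refine (torusDist_le x y 0).trans ((hC _).trans ?_)
    gcongr
    refine (pi_norm_le_iff_of_nonneg zero_le_one).2 fun i => ?_
    have h1 := (x i).2
    have h2 := (y i).2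
    simp only [Set.mem_Icc] at h1 h2
    simp only [Pi.zero_apply, SignType.coe_zero, add_zero, Real.norm_eq_abs, abs_le]
    constructor <;> linarith
  rw [ballVolume, h]
  exact probReal_univ

theorem radiusOfVolume_mem (hm : 0 < m) (x : Cube m) {V : ℝ} (hV : V ≤ 1) :
    0 ≤ radiusOfVolume q x V ∧ V ≤ ballVolume q x (radiusOfVolume q x V) := by
  have hcl : IsClosed {r : ℝ | 0 ≤ r ∧ V ≤ ballVolume q x r} :=
    (isClosed_le continuous_const continuous_id).inter
      (isClosed_le continuous_const (continuous_ballVolume hm x))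
  obtain ⟨R, hR0, hR⟩ := exists_ballVolume_eq_one (q := q) x
  exact hcl.csInf_mem ⟨R, hR0, hV.trans hR.ge⟩ ⟨0, fun r hr => hr.1⟩

/-- A Galois connection between radius and volume; it reduces measurability in the centre x to that
of ball volumes. -/
theorem radiusOfVolume_le_iff (hm : 0 < m) (x : Cube m) {V r : ℝ} (hV : V ≤ 1) (hr : 0 ≤ r) :
    radiusOfVolume q x V ≤ r ↔ V ≤ ballVolume q x r :=
  ⟨fun h => (radiusOfVolume_mem hm x hV).2.trans (ballVolume_mono x h),
    fun h => csInf_le ⟨0, fun _ hr => hr.1⟩ ⟨hr, h⟩⟩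

theorem ballVolume_radiusOfVolume (hm : 0 < m) (x : Cube m) {V : ℝ} (hV0 : 0 ≤ V) (hV : V ≤ 1) :
    ballVolume q x (radiusOfVolume q x V) = V := by
  refine le_antisymm ?_ (radiusOfVolume_mem hm x hV).2
  obtain ⟨R, hR0, hR⟩ := exists_ballVolume_eq_one (q := q) x
  obtain ⟨r, hr, hrV⟩ := intermediate_value_Icc hR0 (continuous_ballVolume hm x).continuousOn
    (show V ∈ Set.Icc _ _ by rw [hR, ballVolume_zero hm]; exact ⟨hV0, hV⟩)
  rw [← hrV]
  exact ballVolume_mono x ((radiusOfVolume_le_iff hm x (hrV ▸ ballVolume_le_one x r) hr.1).2 le_rfl)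

theorem volume_influence (hm : 0 < m) (x : Cube m) {V : ℝ} (hV0 : 0 ≤ V) :
    volume.real (influence q x V) = min 1 V := by
  unfold influence
  split_ifs with h
  · rw [probReal_univ, min_eq_left h.le]
  · rw [min_eq_right (not_lt.1 h)]
    exact ballVolume_radiusOfVolume hm x hV0 (not_lt.1 h)

theorem measurable_radiusOfVolume (hm : 0 < m) {V : ℝ} (hV : V ≤ 1) :
    Measurable fun x : Cube m => radiusOfVolume q x V := by
  refine measurable_of_Iic fun r => ?_
  by_cases hr : 0 ≤ r
  · have h : (fun x : Cube m => radiusOfVolume q x V) ⁻¹' Set.Iic r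
        = {x | V ≤ ballVolume q x r} := by
      ext x
      exact radiusOfVolume_le_iff hm x hV hr
    rw [h]
    refine measurableSet_le measurable_const ?_
    have hS : MeasurableSet {z : Cube m × Cube m | torusDist q z.1 z.2 ≤ r} :=
      measurableSet_le measurable_torusDist measurable_const
    exact (measurable_measure_prodMk_left (ν := (volume : Measure (Cube m))) hS).ennreal_toReal
  · have h : (fun x : Cube m => radiusOfVolume q x V) ⁻¹' Set.Iic r = ∅ := by
      ext x
      simp only [Set.mem_preimage, Set.mem_Iic, Set.mem_empty_iff_false, iff_false, not_le]
      exact (not_le.1 hr).trans_le (radiusOfVolume_mem (q := q) hm x hV).1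
    rw [h]
    exact MeasurableSet.empty

theorem measurableSet_mem_influence (hm : 0 < m) (V : ℝ) :
    MeasurableSet {z : Cube m × Cube m | z.2 ∈ influence q z.1 V} := by
  unfold influence
  split_ifs with h
  · simp
  · exact measurableSet_le measurable_torusDist
      ((measurable_radiusOfVolume hm (not_lt.1 h)).comp measurable_fst)

/-- A point of the region of influence at distance at least `r` forces its volume to be large. -/
theorem ballVolume_le_of_mem_influence (hm : 0 < m) {x y : Cube m} {V r : ℝ} (hV0 : 0 ≤ V)
    (hy : y ∈ influence q x V) (hr : r ≤ torusDist q x y) : ballVolume q x r ≤ V := by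
  unfold influence at hy
  split_ifs at hy with h
  · exact (ballVolume_le_one (q := q) x r).trans h.le
  · exact (ballVolume_mono x (hr.trans hy)).trans_eq
      (ballVolume_radiusOfVolume (q := q) hm x hV0 (not_lt.1 h))

theorem volume_unitInterval_near (a : I) {δ : ℝ} (h0 : 0 ≤ δ) (h1 : δ ≤ 1 / 2) :
    ENNReal.ofReal δ ≤ volume {b : I | |(a : ℝ) - b| ≤ δ} := by
  have ha := a.2
  simp only [Set.mem_Icc] at ha
  have key : ∀ c : ℝ, 0 ≤ c → c + δ ≤ 1 → |(a : ℝ) - c| ≤ δ → |(a : ℝ) - (c + δ)| ≤ δ →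
      ENNReal.ofReal δ ≤ volume {b : I | |(a : ℝ) - b| ≤ δ} := by
    intro c hc0 hc1 hac hacd
    have hsub : Set.Icc c (c + δ) ⊆ Subtype.val '' {b : I | |(a : ℝ) - b| ≤ δ} := by
      intro z hz
      refine ⟨⟨z, hc0.trans hz.1, hz.2.trans hc1⟩, ?_, rfl⟩
      simp only [Set.mem_ofPred_eq, abs_le] at hac hacd ⊢
      constructor <;> linarith [hz.1, hz.2]
    have h := measure_mono (μ := volume) hsub
    rw [Real.volume_Icc, add_sub_cancel_left] at h
    refine h.trans (le_of_eq ?_)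
    exact (comap_subtype_coe_apply measurableSet_Icc volume _).symm
  -- An interval of length δ on one side of a is enough, on whichever side stays inside [0,1]; this
  -- avoids any wrap-around.
  by_cases hh : (a : ℝ) ≤ 1 / 2
  · refine key a ha.1 (by linarith) ?_ ?_ <;> simp [abs_of_nonneg h0, h0]
  · refine key (a - δ) (by linarith) (by linarith) ?_ ?_ <;> simp [abs_of_nonneg h0, h0]

theorem exists_le_ballVolume (m : ℕ) (q : ℝ≥0∞) [Fact (1 ≤ q)] :
    ∃ C : ℝ, 1 ≤ C ∧ ∀ (x : Cube m) (δ : ℝ), 0 ≤ δ → δ ≤ 1 / 2 →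
      δ ^ m ≤ ballVolume q x (C * δ) := by
  obtain ⟨C, hC1, hC⟩ := exists_norm_toLp_le m q
  refine ⟨C, hC1, fun x δ h0 h1 => ?_⟩
  have hsub : (Set.univ.pi fun i => {b : I | |(x i : ℝ) - b| ≤ δ}) ⊆ torusBall q x (C * δ) := by
    intro y hy
    refine (torusDist_le x y 0).trans ((hC _).trans ?_)
    gcongr
    refine (pi_norm_le_iff_of_nonneg h0).2 fun i => ?_
    simpa using hy i trivial
  have h := measure_mono (μ := volume) hsub
  rw [volume_pi_pi] at h
  have h2 : ENNReal.ofReal (δ ^ m) ≤ volume (torusBall q x (C * δ)) := by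
    refine le_trans ?_ h
    rw [ENNReal.ofReal_pow h0]
    calc ENNReal.ofReal δ ^ m = ∏ _i : Fin m, ENNReal.ofReal δ := by simp
      _ ≤ _ := Finset.prod_le_prod' fun i _ => volume_unitInterval_near (x i) h0 h1
  exact (ENNReal.ofReal_le_iff_le_toReal (measure_ne_top _ _)).1 h2

/-- The L_q norm dominates the sup norm, so each of the 3^m translates contributes at most a cube of
side 2r. -/
theorem volume_torusDist_lt_le (x : Cube m) {r : ℝ} (hr : 0 ≤ r) :
    volume.real {y : Cube m | torusDist q x y < r} ≤ 3 ^ m * (2 * r) ^ m := by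
  have hsub : {y : Cube m | torusDist q x y < r} ⊆ ⋃ u : Fin m → SignType,
      {y : Cube m | (fun i => ((x i : ℝ) + (u i : ℝ)) - (y i : ℝ)) ∈
        Metric.closedBall (0 : Fin m → ℝ) r} := by
    intro y hy
    obtain ⟨u, hu⟩ := exists_torusDist_eq (q := q) x y
    refine Set.mem_iUnion.2 ⟨u, ?_⟩
    simp only [Set.mem_ofPred_eq] at hy ⊢
    rw [hu] at hy
    rw [mem_closedBall_zero_iff]
    refine (norm_le_norm_toLp (q := q) _).trans (le_trans (le_of_eq ?_) hy.le)
    congr 2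
    funext i
    ring
  refine (measureReal_mono hsub).trans ((measureReal_iUnion_fintype_le _).trans ?_)
  have h : ∀ u : Fin m → SignType, volume.real
      {y : Cube m | (fun i => ((x i : ℝ) + (u i : ℝ)) - (y i : ℝ)) ∈
        Metric.closedBall (0 : Fin m → ℝ) r} ≤ (2 * r) ^ m := by
    intro u
    have h := volume_sub_mem_le (fun i => (x i : ℝ) + (u i : ℝ))
      (Metric.isClosed_closedBall (x := (0 : Fin m → ℝ)) (ε := r)).measurableSet
    rw [Real.volume_pi_closedBall _ hr, Fintype.card_fin] at h
    exact ENNReal.toReal_le_of_le_ofReal (by positivity) h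
  refine (Finset.sum_le_sum fun u _ => h u).trans (le_of_eq ?_)
  simp [Finset.sum_const, Finset.card_univ, Fintype.card_pi]
  left
  rfl

theorem unitBallVolume_pos (m : ℕ) (q : ℝ≥0∞) [Fact (1 ≤ q)] : 0 < unitBallVolume m q := by
  obtain ⟨C, hC1, hC⟩ := exists_norm_toLp_le m q
  have hC0 : 0 < C := by linarith
  have hlt : volume {x : Fin m → ℝ | ‖WithLp.toLp q x‖ ≤ 1} < ∞ := by
    refine lt_of_le_of_lt (measure_mono (t := Metric.closedBall (0 : Fin m → ℝ) 1) ?_)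
      measure_closedBall_lt_top
    intro w hw
    rw [mem_closedBall_zero_iff]
    exact (norm_le_norm_toLp (q := q) w).trans hw
  refine ENNReal.toReal_pos ?_ hlt.ne
  refine (lt_of_lt_of_le (Metric.measure_ball_pos volume (0 : Fin m → ℝ) (inv_pos.2 hC0))
    (measure_mono ?_)).ne'
  intro w hw
  rw [mem_ball_zero_iff] at hw
  refine (hC w).trans ?_
  calc C * ‖w‖ ≤ C * C⁻¹ := by gcongr
    _ = 1 := mul_inv_cancel₀ hC0.ne'

theorem longThreshold_pow (hm : 0 < m) (α : ℝ) (n : ℕ) :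
    longThreshold m q α n ^ m = (n : ℝ) ^ (-α) / unitBallVolume m q := by
  unfold longThreshold
  rw [one_div, Real.rpow_inv_natCast_pow
    (div_nonneg (Real.rpow_nonneg (Nat.cast_nonneg n) _) (unitBallVolume_pos m q).le) hm.ne']

theorem longThreshold_nonneg (α : ℝ) (n : ℕ) : 0 ≤ longThreshold m q α n :=
  Real.rpow_nonneg
    (div_nonneg (Real.rpow_nonneg (Nat.cast_nonneg n) _) (unitBallVolume_pos m q).le) _

theorem exists_le_ballVolume_longThreshold (hm : 0 < m) {α : ℝ} (hα : 0 ≤ α) :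
    ∃ c : ℝ, 0 < c ∧ ∀ (n : ℕ), 1 ≤ n → ∀ x : Cube m,
      c * (n : ℝ) ^ (-α) ≤ ballVolume q x (longThreshold m q α n) := by
  obtain ⟨C, hC1, hC⟩ := exists_le_ballVolume m q
  have hC0 : 0 < C := by linarith
  have hc := unitBallVolume_pos m q
  set κ := (1 / unitBallVolume m q) with hκ
  have hκ0 : 0 < κ := by positivity
  -- The second entry serves radii too large for the cube bound, which needs δ ≤ 1/2; there n^{-α} ≤
  -- 1 suffices.
  refine ⟨min (κ / C ^ m) ((1 / 2) ^ m), by positivity, fun n hn x => ?_⟩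
  have hn0 : (0 : ℝ) ≤ (n : ℝ) ^ (-α) := Real.rpow_nonneg (Nat.cast_nonneg n) _
  have hn1 : (n : ℝ) ^ (-α) ≤ 1 :=
    Real.rpow_le_one_of_one_le_of_nonpos (by exact_mod_cast hn) (by linarith)
  have hr0 := longThreshold_nonneg (m := m) (q := q) α n
  have hrm := longThreshold_pow (q := q) hm α n
  have hδ0 : 0 ≤ min (longThreshold m q α n / C) (1 / 2) := by positivity
  refine le_trans ?_ ((hC x _ hδ0 (min_le_right _ _)).trans (ballVolume_mono x ?_))
  · rcases min_cases (longThreshold m q α n / C) (1 / 2) with ⟨h, -⟩ | ⟨h, -⟩ <;> rw [h]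
    · rw [div_pow _ C, hrm]
      calc min (κ / C ^ m) ((1 / 2) ^ m) * (n : ℝ) ^ (-α) ≤ κ / C ^ m * (n : ℝ) ^ (-α) := by
            gcongr; exact min_le_left _ _
        _ = _ := by rw [hκ]; ring
    · calc min (κ / C ^ m) ((1 / 2) ^ m) * (n : ℝ) ^ (-α) ≤ (1 / 2) ^ m * 1 := by
            gcongr; exact min_le_right _ _
        _ = _ := mul_one _
  · calc C * min (longThreshold m q α n / C) (1 / 2) ≤ C * (longThreshold m q α n / C) := by
          gcongr; exact min_le_left _ _
      _ = _ := by field_simp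

theorem exists_volume_lt_longThreshold_le (hm : 0 < m) (α : ℝ) :
    ∃ c : ℝ, 0 < c ∧ ∀ (n : ℕ) (x : Cube m),
      volume.real {y : Cube m | torusDist q x y < longThreshold m q α n} ≤ c * (n : ℝ) ^ (-α) := by
  have hc := unitBallVolume_pos m q
  refine ⟨3 ^ m * 2 ^ m / unitBallVolume m q, by positivity, fun n x => ?_⟩
  refine (volume_torusDist_lt_le x (longThreshold_nonneg α n)).trans (le_of_eq ?_)
  rw [mul_pow, longThreshold_pow hm]
  ring

end Geometry

/-! ### The graph process, its adaptedness and measurability -/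

section Dynamics

variable {m : ℕ} (q : ℝ≥0∞) (p A₁ A₂ : ℝ)

/-- The in-degree of `v_s` in `G_t`. -/
noncomputable def degree (s t : ℕ) (ω : Outcome m) : ℕ := inDegree (edges q p A₁ A₂ ω t) s

/-- The nominal volume of the sphere of influence of `v_s` at time `t`. -/
noncomputable def nominalVolume (s t : ℕ) (ω : Outcome m) : ℝ :=
  (A₁ * (degree q p A₁ A₂ s t ω : ℝ) + A₂) / (t : ℝ)

/-- The part of the sphere of influence of `v_s` at time `t` at distance at least `r`. -/
noncomputable def farInfluence (s t : ℕ) (r : ℝ) (ω : Outcome m) : Set (Cube m) :=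
  {y | y ∈ influence q (ω s).1 (nominalVolume q p A₁ A₂ s t ω) ∧ r ≤ torusDist q y (ω s).1}

/-- The event that `v_{t+1}` links to `v_s` over a distance of at least `r`. -/
def linkEvent (s t : ℕ) (r : ℝ) : Set (Outcome m) :=
  {ω | (ω (t + 1)).1 ∈ farInfluence q p A₁ A₂ s t r ω ∧ ((ω (t + 1)).2 s : ℝ) ≤ p}

variable {q p A₁ A₂}

open Classical in
-- With r = 0 the distance condition is void, so `linkEvent` describes ordinary links and long ones
-- alike.
theorem edges_succ [Fact (1 ≤ q)] (ω : Outcome m) (t : ℕ) :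
    edges q p A₁ A₂ ω (t + 1) = edges q p A₁ A₂ ω t ∪
      ((Finset.Icc 1 t).filter fun s => ω ∈ linkEvent q p A₁ A₂ s t 0).image
        fun s => (t + 1, s) := by
  rw [edges]
  congr 2
  refine Finset.filter_congr fun s _ => ?_
  simp [linkEvent, farInfluence, nominalVolume, degree, torusDist_nonneg]

theorem lt_and_le_of_mem_edges {ω : Outcome m} {t : ℕ} {e : ℕ × ℕ}
    (he : e ∈ edges q p A₁ A₂ ω t) : e.2 < e.1 ∧ e.1 ≤ t := by
  induction t with
  | zero => simp [edges] at he
  | succ t ih =>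
    classical
    rw [edges, Finset.mem_union] at he
    rcases he with he | he
    · exact ⟨(ih he).1, (ih he).2.trans t.le_succ⟩
    · obtain ⟨s, hs, rfl⟩ := Finset.mem_image.1 he
      have := Finset.mem_Icc.1 (Finset.mem_filter.1 hs).1
      exact ⟨by simp only; omega, le_rfl⟩

/-- Adaptedness: this is the form in which "independent of the past" is used, since resampling step
t + 1 then leaves the degrees at time t unchanged. -/
theorem edges_congr {ω ω' : Outcome m} {t : ℕ} (h : ∀ i ≤ t, ω i = ω' i) :
    edges q p A₁ A₂ ω t = edges q p A₁ A₂ ω' t := by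
  induction t with
  | zero => rfl
  | succ t ih =>
    classical
    rw [edges, edges, ih fun i hi => h i (hi.trans t.le_succ), h (t + 1) le_rfl]
    congr 2
    refine Finset.filter_congr fun s hs => ?_
    rw [h s ((Finset.mem_Icc.1 hs).2.trans t.le_succ)]

theorem edges_update (ω : Outcome m) (t : ℕ) (z : Cube m × (ℕ → I)) :
    edges q p A₁ A₂ (Function.update ω (t + 1) z) t = edges q p A₁ A₂ ω t :=
  edges_congr fun i hi => Function.update_of_ne (by omega) _ _

theorem degree_update (s t : ℕ) (ω : Outcome m) (z : Cube m × (ℕ → I)) :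
    degree q p A₁ A₂ s t (Function.update ω (t + 1) z) = degree q p A₁ A₂ s t ω := by
  rw [degree, edges_update, degree]

theorem farInfluence_update {s t : ℕ} (hs : s ≤ t) (r : ℝ) (ω : Outcome m)
    (z : Cube m × (ℕ → I)) :
    farInfluence q p A₁ A₂ s t r (Function.update ω (t + 1) z)
      = farInfluence q p A₁ A₂ s t r ω := by
  rw [farInfluence, nominalVolume, degree_update, Function.update_of_ne (by omega)]
  rfl

theorem degree_eq_zero {s t : ℕ} (h : t ≤ s) (ω : Outcome m) : degree q p A₁ A₂ s t ω = 0 := by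
  rw [degree, inDegree, Finset.card_eq_zero, Finset.filter_eq_empty_iff]
  intro e he hes
  have := lt_and_le_of_mem_edges he
  omega

section Links

variable [Fact (1 ≤ q)]

open Classical in
theorem card_filter_edges_succ (P : ℕ × ℕ → Prop) (ω : Outcome m) (t : ℕ) :
    ((edges q p A₁ A₂ ω (t + 1)).filter P).card = ((edges q p A₁ A₂ ω t).filter P).card +
      ∑ s ∈ Finset.Icc 1 t, if ω ∈ linkEvent q p A₁ A₂ s t 0 ∧ P (t + 1, s) then 1 else 0 := by
  rw [edges_succ, Finset.filter_union, Finset.card_union_of_disjoint]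
  · rw [Finset.filter_image, Finset.card_image_of_injective _ (fun a b h => (Prod.ext_iff.1 h).2),
      Finset.filter_filter]
    congr 1
    exact Finset.card_filter _ _
  · refine Finset.disjoint_left.2 fun e he he' => ?_
    have h1 := (lt_and_le_of_mem_edges (Finset.mem_filter.1 he).1).2
    obtain ⟨s, hs, rfl⟩ := Finset.mem_image.1 (Finset.mem_filter.1 he').1
    simp only at h1
    omega

open Classical in
theorem degree_succ {s t : ℕ} (hs : 1 ≤ s) (hst : s ≤ t) (ω : Outcome m) :
    degree q p A₁ A₂ s (t + 1) ω = degree q p A₁ A₂ s t ω +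
      if ω ∈ linkEvent q p A₁ A₂ s t 0 then 1 else 0 := by
  have h := card_filter_edges_succ (q := q) (p := p) (A₁ := A₁) (A₂ := A₂) (fun e => e.2 = s) ω t
  simp only [degree, inDegree]
  convert h using 2
  · congr
  · congr
  · rw [Finset.sum_eq_single s]
    · simp
    · intro b _ hb
      simp [hb]
    · intro h
      exact absurd (Finset.mem_Icc.2 ⟨hs, hst⟩) h

theorem degree_le {s : ℕ} (hs : 1 ≤ s) (t : ℕ) (ω : Outcome m) :
    degree q p A₁ A₂ s t ω ≤ t := by
  induction t with
  | zero => rw [degree_eq_zero (Nat.zero_le s)]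
  | succ t ih =>
    by_cases h : s ≤ t
    · rw [degree_succ hs h]
      split_ifs <;> omega
    · rw [degree_eq_zero (by omega)]
      omega

theorem linkEvent_eq (s t : ℕ) (r : ℝ) :
    (linkEvent q p A₁ A₂ s t r : Set (Outcome m)) =
      linkEvent q p A₁ A₂ s t 0 ∩ {ω | r ≤ torusDist q (ω (t + 1)).1 (ω s).1} := by
  ext ω
  simp only [linkEvent, farInfluence, Set.mem_ofPred_eq, Set.mem_inter_iff, torusDist_nonneg,
    and_true]
  tauto

open Classical in
theorem longEdges_eq_sum (α : ℝ) (n : ℕ) (ω : Outcome m) :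
    longEdges q p A₁ A₂ α n ω = ∑ t ∈ Finset.range n, ∑ s ∈ Finset.Icc 1 t,
      if ω ∈ linkEvent q p A₁ A₂ s t (longThreshold m q α n) then 1 else 0 := by
  unfold longEdges
  generalize longThreshold m q α n = r
  induction n with
  | zero => simp [edges]
  | succ n ih =>
    rw [card_filter_edges_succ, Finset.sum_range_succ, ih]
    congr 1
    refine Finset.sum_congr rfl fun s _ => ?_
    refine if_congr ?_ rfl rfl
    rw [linkEvent_eq s n r]
    rfl

end Links

section Measurability

theorem measurable_position (i : ℕ) : Measurable fun ω : Outcome m => (ω i).1 := by fun_prop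

theorem measurableSet_mem_farInfluence [Fact (1 ≤ q)] (hm : 0 < m) {s t : ℕ} (r : ℝ)
    (hdeg : Measurable (degree q p A₁ A₂ s t : Outcome m → ℕ)) :
    MeasurableSet {ω : Outcome m | (ω (t + 1)).1 ∈ farInfluence q p A₁ A₂ s t r ω} := by
  have h : {ω : Outcome m | (ω (t + 1)).1 ∈ farInfluence q p A₁ A₂ s t r ω} =
      -- Slicing by the value of the degree freezes the nominal volume, so only measurability in the
      -- two positions remains.
      (⋃ k : ℕ, degree q p A₁ A₂ s t ⁻¹' {k} ∩
        (fun ω : Outcome m => ((ω s).1, (ω (t + 1)).1)) ⁻¹'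
          {z : Cube m × Cube m | z.2 ∈ influence q z.1 ((A₁ * (k : ℝ) + A₂) / (t : ℝ))}) ∩
      {ω : Outcome m | r ≤ torusDist q (ω (t + 1)).1 (ω s).1} := by
    ext ω
    simp [farInfluence, nominalVolume]
  rw [h]
  refine MeasurableSet.inter (MeasurableSet.iUnion fun k => ?_) ?_
  · exact (hdeg (measurableSet_singleton k)).inter
      (((measurable_position s).prodMk (measurable_position (t + 1)))
        (measurableSet_mem_influence hm _))
  · exact measurableSet_le measurable_const
      (measurable_torusDist_comp (measurable_position (t + 1)) (measurable_position s))

theorem measurableSet_link_le (i s : ℕ) (p : ℝ) :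
    MeasurableSet {ω : Outcome m | ((ω i).2 s : ℝ) ≤ p} := by
  refine measurableSet_le ?_ measurable_const
  fun_prop

variable [Fact (1 ≤ q)]

theorem measurable_degree (hm : 0 < m) {s : ℕ} (hs : 1 ≤ s) (t : ℕ) :
    Measurable (degree q p A₁ A₂ s t : Outcome m → ℕ) := by
  induction t with
  | zero =>
    have h : (degree q p A₁ A₂ s 0 : Outcome m → ℕ) = fun _ => 0 :=
      funext fun ω => degree_eq_zero (Nat.zero_le s) ω
    rw [h]; exact measurable_const
  | succ t ih =>
    by_cases h : s ≤ t
    · classical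
      have h' : (degree q p A₁ A₂ s (t + 1) : Outcome m → ℕ) = fun ω =>
          degree q p A₁ A₂ s t ω + if ω ∈ linkEvent q p A₁ A₂ s t 0 then 1 else 0 :=
        funext fun ω => degree_succ hs h ω
      rw [h']
      exact ih.add (Measurable.ite ((measurableSet_mem_farInfluence hm 0 ih).inter
        (measurableSet_link_le _ _ _)) measurable_const measurable_const)
    · have h : (degree q p A₁ A₂ s (t + 1) : Outcome m → ℕ) = fun _ => 0 :=
        funext fun ω => degree_eq_zero (by omega) ω
      rw [h]; exact measurable_const

theorem measurableSet_linkEvent (hm : 0 < m) {s : ℕ} (hs : 1 ≤ s) (t : ℕ) (r : ℝ) :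
    MeasurableSet (linkEvent q p A₁ A₂ s t r : Set (Outcome m)) :=
  (measurableSet_mem_farInfluence hm r (measurable_degree hm hs t)).inter
    (measurableSet_link_le _ _ _)

/-- The degree takes values in {0, …, t}, so any function of it is bounded. -/
theorem integrable_comp_degree (hm : 0 < m) {s : ℕ} (hs : 1 ≤ s) (t : ℕ) (φ : ℕ → ℝ) :
    Integrable (fun ω : Outcome m => φ (degree q p A₁ A₂ s t ω)) (law m) := by
  refine Integrable.of_bound
    ((measurable_of_countable φ).comp (measurable_degree hm hs t)).aestronglyMeasurable
    (∑ i ∈ Finset.range (t + 1), ‖φ i‖) (ae_of_all _ fun ω => ?_)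
  exact Finset.single_le_sum (f := fun i => ‖φ i‖) (fun i _ => norm_nonneg _)
    (Finset.mem_range.2 (Nat.lt_succ_of_le (degree_le hs t ω)))

end Measurability

/-! ### Resampling one time-step in place of conditional expectation -/

section Resampling

/-- The law of the randomness of one time-step. -/
noncomputable def stepLaw (m : ℕ) : Measure (Cube m × (ℕ → I)) :=
  (volume : Measure (Cube m)).prod (Measure.infinitePi fun _ : ℕ => (volume : Measure I))

instance : IsProbabilityMeasure (stepLaw m) := by
  unfold stepLaw; infer_instance

/-- Replacing one coordinate of a product measure by an independent copy does not change the law; it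
is enough to compare on cylinders. -/
theorem measurePreserving_update (i : ℕ) :
    MeasurePreserving (fun z : Outcome m × (Cube m × (ℕ → I)) => Function.update z.1 i z.2)
      ((law m).prod (stepLaw m)) (law m) := by
  have hmeas : Measurable
      (fun z : Outcome m × (Cube m × (ℕ → I)) => Function.update z.1 i z.2) := by
    refine measurable_pi_iff.2 fun j => ?_
    by_cases h : j = i
    · subst h
      simpa using measurable_snd
    · simp only [Function.update_of_ne h]
      fun_prop
  refine ⟨hmeas, ?_⟩
  refine Measure.eq_infinitePi _ fun S T hT => ?_
  rw [Measure.map_apply hmeas (MeasurableSet.pi S.countable_toSet fun j _ => hT j)]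
  have hset : (fun z : Outcome m × (Cube m × (ℕ → I)) => Function.update z.1 i z.2) ⁻¹'
      (Set.pi (S : Set ℕ) T) = (Set.pi ((S.erase i : Finset ℕ) : Set ℕ) T) ×ˢ
        (if i ∈ S then T i else Set.univ) := by
    ext z
    simp only [Set.mem_preimage, Set.mem_pi, Set.mem_prod, Finset.mem_coe, Finset.mem_erase]
    constructor
    · intro h
      refine ⟨fun j hj => by simpa [Function.update_of_ne hj.1] using h j hj.2, ?_⟩
      split_ifs with hi
      · simpa using h i hi
      · trivial
    · rintro ⟨h1, h2⟩ j hj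
      by_cases hji : j = i
      · subst hji
        simpa [hj] using h2
      · simpa [Function.update_of_ne hji] using h1 j ⟨hji, hj⟩
  rw [hset, Measure.prod_prod, law, Measure.infinitePi_pi _ fun j _ => hT j]
  by_cases hi : i ∈ S
  · rw [if_pos hi]
    exact Finset.prod_erase_mul S (fun j => stepLaw m (T j)) hi
  · rw [if_neg hi, Finset.erase_eq_of_notMem hi, measure_univ, mul_one]

theorem volume_unitInterval_le (hp₀ : 0 ≤ p) (hp₁ : p ≤ 1) :
    (volume : Measure I).real {b : I | (b : ℝ) ≤ p} = p := by
  have h : {b : I | (b : ℝ) ≤ p} = Set.Iic ⟨p, hp₀, hp₁⟩ := by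
    ext b; exact Iff.rfl
  rw [h, measureReal_def, unitInterval.volume_Iic, ENNReal.toReal_ofReal hp₀]

theorem stepLaw_real (hp₀ : 0 ≤ p) (hp₁ : p ≤ 1) (S : Set (Cube m)) (s : ℕ) :
    (stepLaw m).real {z | z.1 ∈ S ∧ (z.2 s : ℝ) ≤ p} = p * volume.real S := by
  have h : {z : Cube m × (ℕ → I) | z.1 ∈ S ∧ (z.2 s : ℝ) ≤ p} =
      S ×ˢ ((fun f : ℕ → I => f s) ⁻¹' {b : I | (b : ℝ) ≤ p}) := rfl
  rw [h, stepLaw, measureReal_prod_prod, mul_comm]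
  congr 1
  have h2 := (measurePreserving_eval_infinitePi (fun _ : ℕ => (volume : Measure I)) s)
  rw [measureReal_def, h2.measure_preimage
    (measurableSet_le measurable_subtype_coe measurable_const).nullMeasurableSet]
  exact volume_unitInterval_le hp₀ hp₁

/-- Averaging over the randomness of time-step `i`. -/
theorem integral_mul_indicator_step (hp₀ : 0 ≤ p) (hp₁ : p ≤ 1) (i s : ℕ) {G : Outcome m → ℝ}
    (hG : Integrable G (law m)) (hGi : ∀ ω z, G (Function.update ω i z) = G ω)
    {S : Outcome m → Set (Cube m)} (hS : MeasurableSet {ω | (ω i).1 ∈ S ω})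
    (hSi : ∀ ω z, S (Function.update ω i z) = S ω) :
    ∫ ω, G ω * Set.indicator {ω | (ω i).1 ∈ S ω ∧ ((ω i).2 s : ℝ) ≤ p} 1 ω ∂(law m)
      = ∫ ω, G ω * (p * volume.real (S ω)) ∂(law m) := by
  set E : Set (Outcome m) := {ω | (ω i).1 ∈ S ω ∧ ((ω i).2 s : ℝ) ≤ p} with hE
  have hEm : MeasurableSet E := hS.inter (measurableSet_link_le _ _ _)
  have hF : Integrable (fun ω => G ω * E.indicator 1 ω) (law m) := by
    refine (hG.indicator hEm).congr (ae_of_all _ fun ω => ?_)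
    by_cases h : ω ∈ E <;> simp [h]
  have hmp := measurePreserving_update (m := m) i
  have hF' := hmp.integrable_comp_of_integrable hF
  have hmap := integral_map hmp.measurable.aemeasurable
    (by rw [hmp.map_eq]; exact hF.aestronglyMeasurable)
  rw [hmp.map_eq] at hmap
  refine hmap.trans ((integral_prod _ hF').trans ?_)
  simp only [Function.comp_apply]
  refine integral_congr_ae (ae_of_all _ fun ω => ?_)
  have hind : ∀ z, E.indicator (1 : Outcome m → ℝ) (Function.update ω i z) =
      Set.indicator {z : Cube m × (ℕ → I) | z.1 ∈ S ω ∧ (z.2 s : ℝ) ≤ p} 1 z := by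
    intro z
    have hmem : Function.update ω i z ∈ E ↔ z.1 ∈ S ω ∧ (z.2 s : ℝ) ≤ p := by simp [hE, hSi]
    by_cases h : z.1 ∈ S ω ∧ (z.2 s : ℝ) ≤ p
    · rw [Set.indicator_of_mem (hmem.2 h), Set.indicator_of_mem (by exact h)]
      rfl
    · rw [Set.indicator_of_notMem (mt hmem.1 h), Set.indicator_of_notMem (by exact h)]
  simp only [hGi, hind]
  have hSω : MeasurableSet {z : Cube m × (ℕ → I) | z.1 ∈ S ω ∧ (z.2 s : ℝ) ≤ p} := by
    have h : {z : Cube m × (ℕ → I) | z.1 ∈ S ω ∧ (z.2 s : ℝ) ≤ p} =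
        (fun z => Function.update ω i z) ⁻¹' E := by
      ext z
      simp [hE, hSi]
    rw [h]
    exact (measurable_update ω) hEm
  rw [integral_const_mul, integral_indicator_one hSω, stepLaw_real hp₀ hp₁]

end Resampling

/-! ### One-step recursion and the expected number of long edges -/

section Expectation

theorem nominalVolume_nonneg (hA₁ : 0 ≤ A₁) (hA₂ : 0 ≤ A₂) (s t : ℕ) (ω : Outcome m) :
    0 ≤ nominalVolume q p A₁ A₂ s t ω := by
  unfold nominalVolume; positivity

variable [Fact (1 ≤ q)]

theorem farInfluence_zero (s t : ℕ) (ω : Outcome m) :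
    farInfluence q p A₁ A₂ s t 0 ω = influence q (ω s).1 (nominalVolume q p A₁ A₂ s t ω) := by
  simp [farInfluence, torusDist_nonneg]

theorem volume_farInfluence_zero (hm : 0 < m) (hA₁ : 0 ≤ A₁) (hA₂ : 0 ≤ A₂) (s t : ℕ)
    (ω : Outcome m) : volume.real (farInfluence q p A₁ A₂ s t 0 ω) =
      min 1 (nominalVolume q p A₁ A₂ s t ω) := by
  rw [farInfluence_zero, volume_influence hm _ (nominalVolume_nonneg hA₁ hA₂ s t ω)]

/-- Given the past, the degree increases by one with probability p min(1, V). Leaving φ general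
serves both the higher moments and the lower bound for the mean. -/
theorem integral_comp_degree_succ (hm : 0 < m) (hp₀ : 0 ≤ p) (hp₁ : p ≤ 1) (hA₁ : 0 ≤ A₁)
    (hA₂ : 0 ≤ A₂) {s t : ℕ} (hs : 1 ≤ s) (hst : s ≤ t) (φ : ℕ → ℝ) :
    ∫ ω : Outcome m, φ (degree q p A₁ A₂ s (t + 1) ω) ∂(law m) =
      ∫ ω : Outcome m, φ (degree q p A₁ A₂ s t ω) +
        (φ (degree q p A₁ A₂ s t ω + 1) - φ (degree q p A₁ A₂ s t ω)) *
          (p * min 1 (nominalVolume q p A₁ A₂ s t ω)) ∂(law m) := by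
  have hI : Integrable (fun ω : Outcome m => φ (degree q p A₁ A₂ s t ω + 1) -
      φ (degree q p A₁ A₂ s t ω)) (law m) :=
    integrable_comp_degree hm hs t fun k => φ (k + 1) - φ k
  have hI2 : Integrable (fun ω : Outcome m => (φ (degree q p A₁ A₂ s t ω + 1) -
      φ (degree q p A₁ A₂ s t ω)) * (p * min 1 (nominalVolume q p A₁ A₂ s t ω))) (law m) :=
    integrable_comp_degree hm hs t
      fun k => (φ (k + 1) - φ k) * (p * min 1 ((A₁ * (k : ℝ) + A₂) / (t : ℝ)))
  have hL := measurableSet_linkEvent (q := q) (p := p) (A₁ := A₁) (A₂ := A₂) hm hs t 0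
  have hI1 : Integrable (fun ω : Outcome m => (φ (degree q p A₁ A₂ s t ω + 1) -
      φ (degree q p A₁ A₂ s t ω)) * (linkEvent q p A₁ A₂ s t 0).indicator 1 ω) (law m) := by
    refine (hI.indicator hL).congr (ae_of_all _ fun ω => ?_)
    by_cases h : ω ∈ linkEvent q p A₁ A₂ s t 0 <;> simp [h]
  have hφ := integrable_comp_degree (q := q) (p := p) (A₁ := A₁) (A₂ := A₂) hm hs t φ
  have key := integral_mul_indicator_step hp₀ hp₁ (t + 1) s hI
    (fun ω z => by rw [degree_update])
    (measurableSet_mem_farInfluence (q := q) (p := p) (A₁ := A₁) (A₂ := A₂) hm 0 (measurable_degree hm hs t))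
    (fun ω z => farInfluence_update hst 0 ω z)
  rw [integral_add hφ hI2]
  simp only [volume_farInfluence_zero hm hA₁ hA₂] at key
  rw [show {ω : Outcome m | (ω (t + 1)).1 ∈ farInfluence q p A₁ A₂ s t 0 ω ∧
    ((ω (t + 1)).2 s : ℝ) ≤ p} = linkEvent q p A₁ A₂ s t 0 from rfl] at key
  rw [← key]
  refine Eq.trans ?_ (integral_add hφ hI1)
  refine integral_congr_ae (ae_of_all _ fun ω => ?_)
  classical
  simp only [degree_succ hs hst ω]
  by_cases h : ω ∈ linkEvent q p A₁ A₂ s t 0 <;> simp [h]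

theorem law_linkEvent (hm : 0 < m) (hp₀ : 0 ≤ p) (hp₁ : p ≤ 1) {s t : ℕ} (hs : 1 ≤ s)
    (hst : s ≤ t) (r : ℝ) :
    (law m).real (linkEvent q p A₁ A₂ s t r) =
      ∫ ω : Outcome m, p * volume.real (farInfluence q p A₁ A₂ s t r ω) ∂(law m) := by
  have key := integral_mul_indicator_step (m := m) hp₀ hp₁ (t + 1) s (G := fun _ => 1)
    (integrable_const 1) (fun ω z => rfl)
    (measurableSet_mem_farInfluence (q := q) (p := p) (A₁ := A₁) (A₂ := A₂) hm r
      (measurable_degree hm hs t))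
    (fun ω z => farInfluence_update hst r ω z)
  simp only [one_mul] at key
  rw [← key]
  exact (integral_indicator_one (measurableSet_linkEvent hm hs t r)).symm

theorem expectedLongEdges_eq_sum (hm : 0 < m) (α : ℝ) (n : ℕ) :
    expectedLongEdges m q p A₁ A₂ α n = ∑ t ∈ Finset.range n, ∑ s ∈ Finset.Icc 1 t,
      (law m).real (linkEvent q p A₁ A₂ s t (longThreshold m q α n)) := by
  classical
  have h : ∀ ω : Outcome m, (longEdges q p A₁ A₂ α n ω : ℝ) =
      ∑ t ∈ Finset.range n, ∑ s ∈ Finset.Icc 1 t,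
        (linkEvent q p A₁ A₂ s t (longThreshold m q α n)).indicator 1 ω := by
    intro ω
    rw [longEdges_eq_sum]
    push_cast
    rfl
  have hi : ∀ t, ∀ s ∈ Finset.Icc 1 t, Integrable
      (fun ω : Outcome m => (linkEvent q p A₁ A₂ s t (longThreshold m q α n)).indicator
        (1 : Outcome m → ℝ) ω) (law m) := fun t s hs =>
    (integrable_const (1 : ℝ)).indicator
      (measurableSet_linkEvent hm (Finset.mem_Icc.1 hs).1 t _)
  unfold expectedLongEdges
  simp only [h]
  rw [integral_finsetSum _ fun t _ => integrable_finsetSum _ (hi t)]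
  refine Finset.sum_congr rfl fun t _ => ?_
  rw [integral_finsetSum _ (hi t)]
  exact Finset.sum_congr rfl fun s hs =>
    integral_indicator_one (measurableSet_linkEvent hm (Finset.mem_Icc.1 hs).1 t _)

end Expectation

end Dynamics

/-! ### Rising factorials -/

section RisingFactorial

/-- The rising factorial `y (y + 1) ⋯ (y + k - 1)`. -/
noncomputable def risingFactorial (k : ℕ) (y : ℝ) : ℝ := ∏ j ∈ Finset.range k, (y + j)

/-- Both sides are y(y+1)⋯(y+k). Hence y times the forward difference of the rising factorial is k
times the rising factorial: it is an eigenfunction of the degree dynamics without truncation. -/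
theorem mul_risingFactorial_add_one (k : ℕ) (y : ℝ) :
    y * risingFactorial k (y + 1) = (y + k) * risingFactorial k y := by
  have h1 := Finset.prod_range_succ (fun j : ℕ => y + (j : ℝ)) k
  have h2 := Finset.prod_range_succ' (fun j : ℕ => y + (j : ℝ)) k
  rw [h1] at h2
  have h3 : ∏ j ∈ Finset.range k, (y + ((j + 1 : ℕ) : ℝ)) = risingFactorial k (y + 1) :=
    Finset.prod_congr rfl fun j _ => by push_cast; ring
  have h4 : ∏ j ∈ Finset.range k, (y + (j : ℝ)) = risingFactorial k y := rfl
  rw [h3, h4] at h2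
  push_cast at h2
  linarith

theorem risingFactorial_nonneg (k : ℕ) {y : ℝ} (hy : 0 ≤ y) : 0 ≤ risingFactorial k y :=
  Finset.prod_nonneg fun j _ => by positivity

theorem risingFactorial_le_add_one (k : ℕ) {y : ℝ} (hy : 0 ≤ y) :
    risingFactorial k y ≤ risingFactorial k (y + 1) :=
  Finset.prod_le_prod (fun j _ => by positivity) fun j _ => by linarith

theorem pow_le_risingFactorial (k : ℕ) {y : ℝ} (hy : 0 ≤ y) : y ^ k ≤ risingFactorial k y := by
  calc y ^ k = ∏ _j ∈ Finset.range k, y := by simp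
    _ ≤ _ := Finset.prod_le_prod (fun j _ => hy) fun j _ => by
      have : (0 : ℝ) ≤ j := Nat.cast_nonneg j
      linarith

end RisingFactorial

/-! ### Scalar growth recursions -/

section Growth

/-- `t ↦ exp (-c / t) t ^ c` grows at least as fast as `∏ (1 + c / i)`. -/
theorem one_add_div_mul_le {c : ℝ} (hc : 0 ≤ c) {t : ℝ} (ht : 0 < t) :
    (1 + c / t) * (Real.exp (-c / t) * t ^ c) ≤ Real.exp (-c / (t + 1)) * (t + 1) ^ c := by
  have ht1 : 0 < t + 1 := by linarith
  have hlog : 1 - t / (t + 1) ≤ Real.log ((t + 1) / t) := by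
    have := Real.one_sub_inv_le_log_of_pos (div_pos ht1 ht)
    rwa [inv_div] at this
  have h1 : 1 - t / (t + 1) = 1 / (t + 1) := by field_simp; ring
  rw [h1, Real.log_div ht1.ne' ht.ne'] at hlog
  rw [Real.rpow_def_of_pos ht, Real.rpow_def_of_pos ht1, ← Real.exp_add, ← Real.exp_add]
  have h2 : 1 + c / t ≤ Real.exp (c / t) := by
    have := Real.add_one_le_exp (c / t); linarith
  refine (mul_le_mul_of_nonneg_right h2 (Real.exp_pos _).le).trans ?_
  rw [← Real.exp_add, Real.exp_le_exp]
  have h3 := mul_le_mul_of_nonneg_left hlog hc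
  have h4 : c / t + (-c / t + Real.log t * c) = Real.log t * c := by ring
  have h5 : -c / (t + 1) = - (c * (1 / (t + 1))) := by ring
  rw [h4, h5]
  linarith

/-- The ratio of M to exp(-c/t) t^c is non-increasing, and the exponential factor lies between
exp(-c) and 1. -/
theorem le_of_growth {c : ℝ} (hc : 0 ≤ c) {s : ℕ} (hs : 1 ≤ s) {M : ℕ → ℝ}
    (h0 : ∀ t, 0 ≤ M t) (hM : ∀ t, s ≤ t → M (t + 1) ≤ (1 + c / t) * M t) {t : ℕ} (ht : s ≤ t) :
    M t ≤ M s * Real.exp c * ((t : ℝ) / s) ^ c := by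
  have hs0 : (0 : ℝ) < s := by exact_mod_cast hs
  have key : M t * (Real.exp (-c / s) * (s : ℝ) ^ c) ≤
      M s * (Real.exp (-c / t) * (t : ℝ) ^ c) := by
    induction t, ht using Nat.le_induction with
    | base => exact le_rfl
    | succ t ht ih =>
      have ht0 : (0 : ℝ) < t := by exact_mod_cast hs.trans ht
      have hU : 0 ≤ Real.exp (-c / s) * (s : ℝ) ^ c := by positivity
      calc M (t + 1) * (Real.exp (-c / s) * (s : ℝ) ^ c)
          ≤ (1 + c / t) * M t * (Real.exp (-c / s) * (s : ℝ) ^ c) :=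
            mul_le_mul_of_nonneg_right (hM t ht) hU
        _ = (1 + c / t) * (M t * (Real.exp (-c / s) * (s : ℝ) ^ c)) := by ring
        _ ≤ (1 + c / t) * (M s * (Real.exp (-c / t) * (t : ℝ) ^ c)) := by gcongr
        _ = M s * ((1 + c / t) * (Real.exp (-c / t) * (t : ℝ) ^ c)) := by ring
        _ ≤ M s * (Real.exp (-c / (t + 1)) * ((t : ℝ) + 1) ^ c) :=
            mul_le_mul_of_nonneg_left (one_add_div_mul_le hc ht0) (h0 s)
        _ = _ := by push_cast; rfl
  have ht0 : (0 : ℝ) < t := by exact_mod_cast hs.trans ht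
  have h1 : Real.exp (-c / t) ≤ 1 := Real.exp_le_one_iff.2
    (div_nonpos_of_nonpos_of_nonneg (by linarith) ht0.le)
  have h2 : Real.exp (-c) ≤ Real.exp (-c / s) := by
    rw [Real.exp_le_exp, neg_div, neg_le_neg_iff]
    exact div_le_self hc (by exact_mod_cast hs)
  have h3 : M t * (Real.exp (-c) * (s : ℝ) ^ c) ≤ M s * (t : ℝ) ^ c := by
    calc M t * (Real.exp (-c) * (s : ℝ) ^ c) ≤ M t * (Real.exp (-c / s) * (s : ℝ) ^ c) := by
          have := h0 t
          gcongr
      _ ≤ _ := key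
      _ ≤ M s * (1 * (t : ℝ) ^ c) := by
          have := h0 s
          gcongr
      _ = _ := by rw [one_mul]
  have hsc : 0 < (s : ℝ) ^ c := by positivity
  rw [Real.div_rpow ht0.le hs0.le]
  have h4 : M t = M t * (Real.exp (-c) * (s : ℝ) ^ c) * (Real.exp c / (s : ℝ) ^ c) := by
    rw [Real.exp_neg]
    field_simp
  rw [h4]
  calc _ ≤ M s * (t : ℝ) ^ c * (Real.exp c / (s : ℝ) ^ c) := by gcongr
    _ = _ := by ring

/-- The order of magnitude of the volume of the sphere of influence of `v_s` at time `t`. -/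
noncomputable def typicalVolume (a : ℝ) (s t : ℕ) : ℝ := ((t : ℝ) / s) ^ a / t

theorem typicalVolume_nonneg (a : ℝ) (s t : ℕ) : 0 ≤ typicalVolume a s t := by
  unfold typicalVolume; positivity

theorem typicalVolume_le {a : ℝ} (ha : a ≤ 1) {s t : ℕ} (hs : 1 ≤ s) (hst : s ≤ t) :
    typicalVolume a s t ≤ 1 / s := by
  have hs0 : (0 : ℝ) < s := by exact_mod_cast hs
  have ht0 : (0 : ℝ) < t := by exact_mod_cast hs.trans hst
  have h1 : 1 ≤ (t : ℝ) / s := by rw [one_le_div hs0]; exact_mod_cast hst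
  calc typicalVolume a s t ≤ ((t : ℝ) / s) ^ (1 : ℝ) / t := by
        unfold typicalVolume
        gcongr
    _ = 1 / s := by rw [Real.rpow_one]; field_simp

/-- By Bernoulli, (t/s)^a grows by at most the factor 1 + a/t. After division by (t/s)^a the
quadratic error at time t is K s^{-a} t^{a-2}, so the errors simply add up. -/
theorem ge_of_growth {a β K : ℝ} (ha0 : 0 ≤ a) (ha1 : a ≤ 1) (hK : 0 ≤ K) {s : ℕ}
    (hs : 1 ≤ s) {f : ℕ → ℝ} (hfs : f s = β)
    (hf : ∀ t, s ≤ t → (1 + a / t) * f t - K * typicalVolume a s t ^ 2 ≤ f (t + 1))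
    (hsum : ∀ t, K * (s : ℝ) ^ (-a) * ∑ i ∈ Finset.Ico s t, (i : ℝ) ^ (a - 2) ≤ β) {t : ℕ}
    (ht : s ≤ t) :
    ((t : ℝ) / s) ^ a * (β - K * (s : ℝ) ^ (-a) * ∑ i ∈ Finset.Ico s t, (i : ℝ) ^ (a - 2))
      ≤ f t := by
  have hs0 : (0 : ℝ) < s := by exact_mod_cast hs
  induction t, ht using Nat.le_induction with
  | base => simp [hfs, div_self hs0.ne']
  | succ t ht ih =>
    have ht0 : (0 : ℝ) < t := by exact_mod_cast hs.trans ht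
    refine le_trans ?_ (hf t ht)
    rw [Finset.sum_Ico_succ_top ht]
    set g := β - K * (s : ℝ) ^ (-a) * ∑ i ∈ Finset.Ico s t, (i : ℝ) ^ (a - 2) with hg
    -- Nonnegativity of the bracket is what allows it to be multiplied through the Bernoulli
    -- inequality.
    have hg0 : 0 ≤ g := by rw [hg]; linarith [hsum t]
    have hbern : (((t + 1 : ℕ) : ℝ) / s) ^ a ≤ (1 + a / t) * ((t : ℝ) / s) ^ a := by
      have h1 : ((t + 1 : ℕ) : ℝ) / s = (1 + 1 / t) * ((t : ℝ) / s) := by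
        push_cast; field_simp
      rw [h1, Real.mul_rpow (by positivity) (by positivity)]
      have h2 := rpow_one_add_le_one_add_mul_self (s := 1 / (t : ℝ))
        (by have : 0 < 1 / (t : ℝ) := by positivity
            linarith) ha0 ha1
      rw [mul_one_div] at h2
      gcongr
    have hw : typicalVolume a s t ^ 2 = ((t : ℝ) / s) ^ a * ((s : ℝ) ^ (-a) * (t : ℝ) ^ (a - 2)) := by
      rw [typicalVolume, Real.div_rpow ht0.le hs0.le, Real.rpow_neg hs0.le,
        Real.rpow_sub ht0, Real.rpow_two]
      have := (Real.rpow_pos_of_pos hs0 a).ne'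
      field_simp
    have hmono : ((t : ℝ) / s) ^ a ≤ (((t + 1 : ℕ) : ℝ) / s) ^ a := by
      gcongr; omega
    have h3 : (((t + 1 : ℕ) : ℝ) / s) ^ a * g ≤ (1 + a / t) * f t := by
      calc _ ≤ (1 + a / t) * ((t : ℝ) / s) ^ a * g := by gcongr
        _ = (1 + a / t) * (((t : ℝ) / s) ^ a * g) := by ring
        _ ≤ _ := by gcongr
    have h4 : K * typicalVolume a s t ^ 2 ≤
        (((t + 1 : ℕ) : ℝ) / s) ^ a * (K * (s : ℝ) ^ (-a) * (t : ℝ) ^ (a - 2)) := by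
      rw [hw]
      calc K * (((t : ℝ) / s) ^ a * ((s : ℝ) ^ (-a) * (t : ℝ) ^ (a - 2)))
          = ((t : ℝ) / s) ^ a * (K * (s : ℝ) ^ (-a) * (t : ℝ) ^ (a - 2)) := by ring
        _ ≤ _ := by gcongr
    have h5 : β - K * (s : ℝ) ^ (-a) * (∑ i ∈ Finset.Ico s t, (i : ℝ) ^ (a - 2) +
        (t : ℝ) ^ (a - 2)) = g - K * (s : ℝ) ^ (-a) * (t : ℝ) ^ (a - 2) := by rw [hg]; ring
    rw [h5, mul_sub]
    linarith

/-- Since a < 1 the series converges, and the prefactor s^{-a} tends to 0. This is why the lower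
bound on the mean is obtained only for s beyond some s₀. -/
theorem exists_small_tail {a K ε : ℝ} (ha0 : 0 < a) (ha1 : a < 1) (hK : 0 ≤ K) (hε : 0 < ε) :
    ∃ s₀ : ℕ, 1 ≤ s₀ ∧ ∀ s, s₀ ≤ s → ∀ t,
      K * (s : ℝ) ^ (-a) * ∑ i ∈ Finset.Ico s t, (i : ℝ) ^ (a - 2) ≤ ε := by
  have hsum : Summable fun i : ℕ => (i : ℝ) ^ (a - 2) :=
    Real.summable_nat_rpow.2 (by linarith)
  set B := ∑' i : ℕ, (i : ℝ) ^ (a - 2) with hB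
  have hlim : Tendsto (fun s : ℕ => K * (s : ℝ) ^ (-a) * B) atTop (𝓝 0) := by
    have h := (tendsto_rpow_neg_atTop ha0).comp (tendsto_natCast_atTop_atTop (R := ℝ))
    have h2 := (h.const_mul K).mul_const B
    simpa using h2
  obtain ⟨s₁, hs₁⟩ := eventually_atTop.1 (hlim.eventually_le_const hε)
  refine ⟨max 1 s₁, le_max_left _ _, fun s hs t => ?_⟩
  refine le_trans ?_ (hs₁ s ((le_max_right _ _).trans hs))
  gcongr
  exact hsum.sum_le_tsum _ fun i _ => by positivity

end Growth

/-! ### Moments of the sphere of influence -/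

section Moments

variable {m : ℕ} {q : ℝ≥0∞} {p A₁ A₂ : ℝ}

variable (q p A₁ A₂) in
/-- The shifted in-degree, proportional to the volume of the sphere of influence. -/
noncomputable def weight (s t : ℕ) (ω : Outcome m) : ℝ := degree q p A₁ A₂ s t ω + A₂ / A₁

theorem nominalVolume_eq (hA₁ : 0 < A₁) (s t : ℕ) (ω : Outcome m) :
    nominalVolume q p A₁ A₂ s t ω = A₁ * weight q p A₁ A₂ s t ω / t := by
  rw [nominalVolume, weight, mul_add, mul_div_cancel₀ _ hA₁.ne']

theorem weight_nonneg (hA₁ : 0 < A₁) (hA₂ : 0 < A₂) (s t : ℕ) (ω : Outcome m) :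
    0 ≤ weight q p A₁ A₂ s t ω := by
  unfold weight; positivity

theorem weight_self (s : ℕ) (ω : Outcome m) : weight q p A₁ A₂ s s ω = A₂ / A₁ := by
  rw [weight, degree_eq_zero le_rfl, Nat.cast_zero, zero_add]

variable [Fact (1 ≤ q)]

/-- Dropping the truncation at 1 only increases the drift, and the eigenfunction identity then
closes the recursion. -/
theorem integral_risingFactorial_succ_le (hm : 0 < m) (hp₀ : 0 ≤ p) (hp₁ : p ≤ 1) (hA₁ : 0 < A₁)
    (hA₂ : 0 < A₂) (k : ℕ) {s t : ℕ} (hs : 1 ≤ s) (hst : s ≤ t) :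
    ∫ ω : Outcome m, risingFactorial k (weight q p A₁ A₂ s (t + 1) ω) ∂(law m) ≤
      (1 + p * A₁ * k / t) *
        ∫ ω : Outcome m, risingFactorial k (weight q p A₁ A₂ s t ω) ∂(law m) := by
  have h := integral_comp_degree_succ (m := m) (q := q) hm hp₀ hp₁ hA₁.le hA₂.le hs hst
    (fun d => risingFactorial k (d + A₂ / A₁))
  have ht0 : (0 : ℝ) < t := by exact_mod_cast hs.trans hst
  unfold weight
  rw [h, ← integral_const_mul]
  refine integral_mono ?_ ((integrable_comp_degree hm hs t
    fun d => risingFactorial k (d + A₂ / A₁)).const_mul _) fun ω => ?_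
  · exact integrable_comp_degree hm hs t fun d => risingFactorial k (d + A₂ / A₁) +
      (risingFactorial k ((d + 1 : ℕ) + A₂ / A₁) - risingFactorial k (d + A₂ / A₁)) *
        (p * min 1 ((A₁ * (d : ℝ) + A₂) / (t : ℝ)))
  · simp only
    have hy := weight_nonneg (q := q) (p := p) hA₁ hA₂ s t ω
    rw [nominalVolume_eq hA₁, weight] at *
    set y := (degree q p A₁ A₂ s t ω : ℝ) + A₂ / A₁ with hyd
    have hy1 : ((degree q p A₁ A₂ s t ω + 1 : ℕ) : ℝ) + A₂ / A₁ = y + 1 := by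
      rw [hyd]; push_cast; ring
    rw [hy1]
    have hmul := mul_risingFactorial_add_one k y
    have hinc := risingFactorial_le_add_one k hy
    calc risingFactorial k y + (risingFactorial k (y + 1) - risingFactorial k y) *
          (p * min 1 (A₁ * y / t))
        ≤ risingFactorial k y + (risingFactorial k (y + 1) - risingFactorial k y) *
          (p * (A₁ * y / t)) := by
          have := sub_nonneg.2 hinc
          gcongr
          exact min_le_right _ _
      _ = risingFactorial k y + p * A₁ / t *
          (y * risingFactorial k (y + 1) - y * risingFactorial k y) := by ring
      _ = (1 + p * A₁ * k / t) * risingFactorial k y := by rw [hmul]; ring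

theorem integrable_weight_pow (hm : 0 < m) (k : ℕ) {s : ℕ} (hs : 1 ≤ s) (t : ℕ) :
    Integrable (fun ω : Outcome m => weight q p A₁ A₂ s t ω ^ k) (law m) :=
  integrable_comp_degree hm hs t fun d => ((d : ℝ) + A₂ / A₁) ^ k

theorem exists_integral_nominalVolume_pow_le (hm : 0 < m) (hp₀ : 0 ≤ p) (hp₁ : p ≤ 1)
    (hA₁ : 0 < A₁) (hA₂ : 0 < A₂) (k : ℕ) :
    ∃ C : ℝ, 0 < C ∧ ∀ s t : ℕ, 1 ≤ s → s ≤ t →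
      ∫ ω : Outcome m, nominalVolume q p A₁ A₂ s t ω ^ k ∂(law m)
        ≤ C * typicalVolume (p * A₁) s t ^ k := by
  have hβ : 0 < A₂ / A₁ := by positivity
  have hR : 0 < risingFactorial k (A₂ / A₁) := (pow_pos hβ k).trans_le
    (pow_le_risingFactorial k hβ.le)
  refine ⟨A₁ ^ k * (risingFactorial k (A₂ / A₁) * Real.exp (p * A₁ * k)), by positivity,
    fun s t hs hst => ?_⟩
  have hc : 0 ≤ p * A₁ * k := by positivity
  have ht0 : (0 : ℝ) < t := by exact_mod_cast hs.trans hst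
  have hs0 : (0 : ℝ) < s := by exact_mod_cast hs
  have key := le_of_growth hc hs
    (M := fun t => ∫ ω : Outcome m, risingFactorial k (weight q p A₁ A₂ s t ω) ∂(law m))
    (fun t => integral_nonneg fun ω => risingFactorial_nonneg k (weight_nonneg hA₁ hA₂ s t ω))
    (fun t ht => integral_risingFactorial_succ_le hm hp₀ hp₁ hA₁ hA₂ k hs ht) hst
  simp only [weight_self, integral_const, probReal_univ, one_smul] at key
  have hpow : ∫ ω : Outcome m, weight q p A₁ A₂ s t ω ^ k ∂(law m) ≤
      ∫ ω : Outcome m, risingFactorial k (weight q p A₁ A₂ s t ω) ∂(law m) :=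
    integral_mono (integrable_weight_pow hm k hs t)
      (integrable_comp_degree hm hs t fun d => risingFactorial k ((d : ℝ) + A₂ / A₁))
      fun ω => pow_le_risingFactorial k (weight_nonneg hA₁ hA₂ s t ω)
  have hV : ∀ ω : Outcome m, nominalVolume q p A₁ A₂ s t ω ^ k =
      (A₁ / t) ^ k * weight q p A₁ A₂ s t ω ^ k := fun ω => by
    rw [nominalVolume_eq hA₁, ← mul_pow]; ring
  simp only [hV]
  rw [integral_const_mul]
  calc (A₁ / t) ^ k * ∫ ω : Outcome m, weight q p A₁ A₂ s t ω ^ k ∂(law m)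
      ≤ (A₁ / t) ^ k * (risingFactorial k (A₂ / A₁) * Real.exp (p * A₁ * k) *
          ((t : ℝ) / s) ^ (p * A₁ * k)) := by
        gcongr
        exact hpow.trans key
    _ = _ := by
        rw [typicalVolume, Real.rpow_mul (by positivity), Real.rpow_natCast, div_pow, div_pow]
        ring

/-- Uses min(1, V) ≥ V - V², which charges the truncation to the second moment already bounded. -/
theorem integral_weight_succ_ge (hm : 0 < m) (hp₀ : 0 ≤ p) (hp₁ : p ≤ 1)
    (hA₁ : 0 < A₁) (hA₂ : 0 < A₂) {s t : ℕ} (hs : 1 ≤ s) (hst : s ≤ t) :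
    (1 + p * A₁ / t) * ∫ ω : Outcome m, weight q p A₁ A₂ s t ω ∂(law m) -
      p * ∫ ω : Outcome m, nominalVolume q p A₁ A₂ s t ω ^ 2 ∂(law m) ≤
    ∫ ω : Outcome m, weight q p A₁ A₂ s (t + 1) ω ∂(law m) := by
  have h := integral_comp_degree_succ (m := m) (q := q) hm hp₀ hp₁ hA₁.le hA₂.le hs hst
    (fun d => (d : ℝ) + A₂ / A₁)
  have hi1 : Integrable (fun ω : Outcome m => weight q p A₁ A₂ s t ω) (law m) :=
    integrable_comp_degree hm hs t fun d => (d : ℝ) + A₂ / A₁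
  have hi2 : Integrable (fun ω : Outcome m => nominalVolume q p A₁ A₂ s t ω ^ 2) (law m) :=
    integrable_comp_degree hm hs t fun d => ((A₁ * (d : ℝ) + A₂) / (t : ℝ)) ^ 2
  rw [← integral_const_mul, ← integral_const_mul, ← integral_sub (hi1.const_mul _) (hi2.const_mul _)]
  unfold weight at hi1 ⊢
  rw [h]
  refine integral_mono ((hi1.const_mul _).sub (hi2.const_mul _))
    (integrable_comp_degree hm hs t fun d => ((d : ℝ) + A₂ / A₁) +
      (((d + 1 : ℕ) + A₂ / A₁) - (d + A₂ / A₁)) *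
        (p * min 1 ((A₁ * (d : ℝ) + A₂) / (t : ℝ)))) fun ω => ?_
  simp only
  have hV0 := nominalVolume_nonneg (q := q) (p := p) hA₁.le hA₂.le s t ω
  have hmin : nominalVolume q p A₁ A₂ s t ω - nominalVolume q p A₁ A₂ s t ω ^ 2 ≤
      min 1 (nominalVolume q p A₁ A₂ s t ω) := by
    refine le_min ?_ ?_ <;> nlinarith [sq_nonneg (nominalVolume q p A₁ A₂ s t ω - 1)]
  have h1 := mul_le_mul_of_nonneg_left hmin hp₀
  have h2 : p * nominalVolume q p A₁ A₂ s t ω =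
      p * A₁ / t * ((degree q p A₁ A₂ s t ω : ℝ) + A₂ / A₁) := by
    rw [nominalVolume_eq hA₁, weight]; ring
  push_cast
  have h3 : ((degree q p A₁ A₂ s t ω : ℝ) + 1 + A₂ / A₁ -
    ((degree q p A₁ A₂ s t ω : ℝ) + A₂ / A₁)) = 1 := by ring
  rw [h3]
  rw [mul_sub, h2] at h1
  linarith

theorem exists_le_integral_nominalVolume (hm : 0 < m) (hp₀ : 0 < p) (hp₁ : p ≤ 1)
    (hA₁ : 0 < A₁) (hA₂ : 0 < A₂) (ha : p * A₁ < 1) :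
    ∃ c : ℝ, 0 < c ∧ ∃ s₀ : ℕ, 1 ≤ s₀ ∧ ∀ s t : ℕ, s₀ ≤ s → s ≤ t →
      c * typicalVolume (p * A₁) s t ≤
        ∫ ω : Outcome m, nominalVolume q p A₁ A₂ s t ω ∂(law m) := by
  have hβ : 0 < A₂ / A₁ := by positivity
  have ha0 : 0 < p * A₁ := by positivity
  obtain ⟨C, hC0, hC⟩ := exists_integral_nominalVolume_pow_le (m := m) (q := q) hm hp₀.le hp₁
    hA₁ hA₂ 2
  have hK : 0 ≤ p * C := by positivity
  obtain ⟨s₀, hs₀, htail⟩ := exists_small_tail ha0 ha hK (half_pos hβ)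
  refine ⟨A₁ * (A₂ / A₁ / 2), by positivity, s₀, hs₀, fun s t hs hst => ?_⟩
  have hs1 : 1 ≤ s := hs₀.trans hs
  have key := ge_of_growth (β := A₂ / A₁) (K := p * C) ha0.le ha.le hK hs1
    (f := fun t => ∫ ω : Outcome m, weight q p A₁ A₂ s t ω ∂(law m))
    (by simp [weight_self]) (fun t ht => by
      refine le_trans ?_ (integral_weight_succ_ge hm hp₀.le hp₁ hA₁ hA₂ hs1 ht)
      have := mul_le_mul_of_nonneg_left (hC s t hs1 ht) hp₀.le
      linarith) (fun t => (htail s hs t).trans (by linarith)) hst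
  have h1 : ((t : ℝ) / s) ^ (p * A₁) * (A₂ / A₁ / 2) ≤
      ∫ ω : Outcome m, weight q p A₁ A₂ s t ω ∂(law m) := by
    refine le_trans ?_ key
    gcongr
    linarith [htail s hs t]
  have hV : ∀ ω : Outcome m, nominalVolume q p A₁ A₂ s t ω =
      (A₁ / t) * weight q p A₁ A₂ s t ω := fun ω => by
    rw [nominalVolume_eq hA₁]; ring
  simp only [hV]
  rw [integral_const_mul]
  calc A₁ * (A₂ / A₁ / 2) * typicalVolume (p * A₁) s t
      = A₁ / t * (((t : ℝ) / s) ^ (p * A₁) * (A₂ / A₁ / 2)) := by rw [typicalVolume]; ring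
    _ ≤ _ := by gcongr

end Moments

/-! ### Probability of a long link -/

section LinkProbability

variable {m : ℕ} {q : ℝ≥0∞} {p A₁ A₂ : ℝ} [Fact (1 ≤ q)]

/-- A pointwise Markov inequality: the far part is empty unless V ≥ b, and then the extra factor
(V/b)^k is at least 1. -/
theorem volume_farInfluence_le (hm : 0 < m) (hA₁ : 0 < A₁) (hA₂ : 0 < A₂) (s t : ℕ) {r b : ℝ}
    (hb : 0 < b) (hr : ∀ x : Cube m, b ≤ ballVolume q x r) (k : ℕ) (ω : Outcome m) :
    volume.real (farInfluence q p A₁ A₂ s t r ω) ≤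
      nominalVolume q p A₁ A₂ s t ω * (nominalVolume q p A₁ A₂ s t ω / b) ^ k := by
  have hV0 := nominalVolume_nonneg (q := q) (p := p) hA₁.le hA₂.le s t ω
  rcases (farInfluence q p A₁ A₂ s t r ω).eq_empty_or_nonempty with h | ⟨y, hy1, hy2⟩
  · rw [h, measureReal_empty]
    positivity
  · rw [torusDist_comm] at hy2
    have hbV := (hr _).trans (ballVolume_le_of_mem_influence hm hV0 hy1 hy2)
    calc volume.real (farInfluence q p A₁ A₂ s t r ω)
        ≤ volume.real (influence q (ω s).1 (nominalVolume q p A₁ A₂ s t ω)) :=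
          measureReal_mono fun z hz => hz.1
      _ ≤ nominalVolume q p A₁ A₂ s t ω * 1 := by
          rw [volume_influence hm _ hV0, mul_one]
          exact min_le_right _ _
      _ ≤ _ := by
          gcongr
          exact one_le_pow₀ ((one_le_div hb).2 hbV)

theorem exists_law_linkEvent_le (hm : 0 < m) (hp₀ : 0 < p) (hp₁ : p ≤ 1)
    (hA₁ : 0 < A₁) (hA₂ : 0 < A₂) {α : ℝ} (hα : 0 ≤ α) (k : ℕ) :
    ∃ C : ℝ, 0 < C ∧ ∀ n s t : ℕ, 1 ≤ n → 1 ≤ s → s ≤ t →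
      (law m).real (linkEvent q p A₁ A₂ s t (longThreshold m q α n)) ≤
        C * (typicalVolume (p * A₁) s t * (typicalVolume (p * A₁) s t * (n : ℝ) ^ α) ^ k) := by
  obtain ⟨C, hC0, hC⟩ := exists_integral_nominalVolume_pow_le (m := m) (q := q) hm hp₀.le hp₁
    hA₁ hA₂ (k + 1)
  obtain ⟨c, hc0, hc⟩ := exists_le_ballVolume_longThreshold (q := q) hm hα
  refine ⟨p * C / c ^ k, by positivity, fun n s t hn hs hst => ?_⟩
  have hn0 : (0 : ℝ) < n := by exact_mod_cast hn
  have hb : 0 < c * (n : ℝ) ^ (-α) := by positivity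
  rw [law_linkEvent hm hp₀.le hp₁ hs hst]
  have hi : Integrable (fun ω : Outcome m => nominalVolume q p A₁ A₂ s t ω ^ (k + 1)) (law m) :=
    integrable_comp_degree hm hs t fun d => ((A₁ * (d : ℝ) + A₂) / (t : ℝ)) ^ (k + 1)
  calc ∫ ω : Outcome m, p * volume.real
        (farInfluence q p A₁ A₂ s t (longThreshold m q α n) ω) ∂(law m)
      ≤ ∫ ω : Outcome m, p * ((n : ℝ) ^ α / c) ^ k *
          nominalVolume q p A₁ A₂ s t ω ^ (k + 1) ∂(law m) := by
        refine integral_mono_of_nonneg (ae_of_all _ fun ω => by positivity)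
          (hi.const_mul _) (ae_of_all _ fun ω => ?_)
        simp only
        rw [mul_assoc]
        gcongr
        refine (volume_farInfluence_le hm hA₁ hA₂ s t hb (hc n hn) k ω).trans (le_of_eq ?_)
        rw [Real.rpow_neg hn0.le, div_pow, div_pow, mul_pow, inv_pow]
        field_simp
        ring
    _ = p * ((n : ℝ) ^ α / c) ^ k *
          ∫ ω : Outcome m, nominalVolume q p A₁ A₂ s t ω ^ (k + 1) ∂(law m) :=
        integral_const_mul _ _
    _ ≤ p * ((n : ℝ) ^ α / c) ^ k * (C * typicalVolume (p * A₁) s t ^ (k + 1)) := by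
        gcongr
        exact hC s t hs hst
    _ = _ := by rw [div_pow, mul_pow, pow_succ]; ring

/-- Every link is long or lands within r_α of its target; the second case costs at most p times the
volume of a ball of radius r_α. -/
theorem exists_le_law_linkEvent (hm : 0 < m) (hp₀ : 0 < p) (hp₁ : p ≤ 1)
    (hA₁ : 0 < A₁) (hA₂ : 0 < A₂) (α : ℝ) :
    ∃ C : ℝ, 0 < C ∧ ∀ n s t : ℕ, 1 ≤ s → s ≤ t →
      p * ∫ ω : Outcome m, min 1 (nominalVolume q p A₁ A₂ s t ω) ∂(law m) - C * (n : ℝ) ^ (-α) ≤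
      (law m).real (linkEvent q p A₁ A₂ s t (longThreshold m q α n)) := by
  obtain ⟨c, hc0, hc⟩ := exists_volume_lt_longThreshold_le (q := q) hm α
  refine ⟨p * c, by positivity, fun n s t hs hst => ?_⟩
  set r := longThreshold m q α n with hr
  set E : Set (Outcome m) := {ω | (ω (t + 1)).1 ∈ {y | torusDist q (ω s).1 y < r} ∧
    ((ω (t + 1)).2 s : ℝ) ≤ p} with hE
  have hmeas : MeasurableSet {ω : Outcome m | (ω (t + 1)).1 ∈ {y | torusDist q (ω s).1 y < r}} :=
    measurableSet_lt (measurable_torusDist_comp (measurable_position s)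
      (measurable_position (t + 1))) measurable_const
  have h0 := law_linkEvent (m := m) (q := q) (A₁ := A₁) (A₂ := A₂) hm hp₀.le hp₁ hs hst 0
  simp only [volume_farInfluence_zero hm hA₁.le hA₂.le] at h0
  rw [integral_const_mul] at h0
  have hsub : linkEvent q p A₁ A₂ s t 0 ⊆ linkEvent q p A₁ A₂ s t r ∪ E := by
    intro ω hω
    by_cases h : r ≤ torusDist q (ω (t + 1)).1 (ω s).1
    · left
      rw [linkEvent_eq]
      exact ⟨hω, h⟩
    · right
      refine ⟨?_, hω.2⟩
      rw [torusDist_comm] at h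
      exact not_le.1 h
  have h1 := (measureReal_mono (μ := law m) hsub).trans (measureReal_union_le _ _)
  have h2 : (law m).real E ≤ p * (c * (n : ℝ) ^ (-α)) := by
    have key := integral_mul_indicator_step (m := m) hp₀.le hp₁ (t + 1) s (G := fun _ => 1)
      (integrable_const 1) (fun ω z => rfl) hmeas (fun ω z => by
        rw [Function.update_of_ne (by omega)])
    simp only [one_mul] at key
    have h3 : (law m).real E =
        ∫ ω : Outcome m, p * volume.real {y | torusDist q (ω s).1 y < r} ∂(law m) := by
      rw [← key]
      exact (integral_indicator_one (hmeas.inter (measurableSet_link_le _ _ _))).symm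
    rw [h3]
    calc _ ≤ ∫ _ω : Outcome m, p * (c * (n : ℝ) ^ (-α)) ∂(law m) := by
          refine integral_mono_of_nonneg (ae_of_all _ fun ω => by positivity)
            (integrable_const _) (ae_of_all _ fun ω => ?_)
          simp only
          gcongr
          exact hc n _
      _ = _ := by simp
  rw [h0] at h1
  linarith

/-- Discards the in-degree, keeping V ≥ A₂/t. Unlike the bound through `typicalVolume` it holds for
every s ≥ 1. -/
theorem exists_le_law_linkEvent_of_time (hm : 0 < m) (hp₀ : 0 < p) (hp₁ : p ≤ 1)
    (hA₁ : 0 < A₁) (hA₂ : 0 < A₂) (α : ℝ) :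
    ∃ C : ℝ, 0 < C ∧ ∀ n s t : ℕ, 1 ≤ s → s ≤ t →
      p * min 1 (A₂ / t) - C * (n : ℝ) ^ (-α) ≤
      (law m).real (linkEvent q p A₁ A₂ s t (longThreshold m q α n)) := by
  obtain ⟨C, hC0, hC⟩ := exists_le_law_linkEvent (m := m) (q := q) hm hp₀ hp₁ hA₁ hA₂ α
  refine ⟨C, hC0, fun n s t hs hst => le_trans ?_ (hC n s t hs hst)⟩
  gcongr
  have hi : Integrable (fun ω : Outcome m => min 1 (nominalVolume q p A₁ A₂ s t ω)) (law m) :=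
    integrable_comp_degree hm hs t fun d => min 1 ((A₁ * (d : ℝ) + A₂) / (t : ℝ))
  calc min 1 (A₂ / t) = ∫ _ω : Outcome m, min 1 (A₂ / t) ∂(law m) := by simp
    _ ≤ _ := by
      refine integral_mono (integrable_const _) hi fun ω => ?_
      simp only [nominalVolume]
      gcongr
      have : 0 ≤ A₁ * (degree q p A₁ A₂ s t ω : ℝ) := by positivity
      linarith

theorem exists_le_law_linkEvent_of_typicalVolume (hm : 0 < m) (hp₀ : 0 < p) (hp₁ : p ≤ 1)
    (hA₁ : 0 < A₁) (hA₂ : 0 < A₂) (ha : p * A₁ < 1) (α : ℝ) :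
    ∃ c C : ℝ, 0 < c ∧ 0 < C ∧ ∃ s₀ : ℕ, 1 ≤ s₀ ∧ ∀ n s t : ℕ, s₀ ≤ s → s ≤ t →
      c * typicalVolume (p * A₁) s t - C * (n : ℝ) ^ (-α) ≤
      (law m).real (linkEvent q p A₁ A₂ s t (longThreshold m q α n)) := by
  obtain ⟨C, hC0, hC⟩ := exists_le_law_linkEvent (m := m) (q := q) hm hp₀ hp₁ hA₁ hA₂ α
  obtain ⟨c, hc0, s₁, hs₁, hc⟩ := exists_le_integral_nominalVolume (m := m) (q := q) hm hp₀ hp₁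
    hA₁ hA₂ ha
  obtain ⟨K, hK0, hK⟩ := exists_integral_nominalVolume_pow_le (m := m) (q := q) hm hp₀.le hp₁
    hA₁ hA₂ 2
  obtain ⟨s₂, hs₂⟩ := exists_nat_gt (K / (c / 2))
  refine ⟨p * (c / 2), C, by positivity, hC0, max s₁ s₂, hs₁.trans (le_max_left _ _),
    fun n s t hs hst => ?_⟩
  have hss₁ : s₁ ≤ s := (le_max_left _ _).trans hs
  have hs1 : 1 ≤ s := hs₁.trans hss₁
  have hs0 : (0 : ℝ) < s := by exact_mod_cast hs1
  have hw0 := typicalVolume_nonneg (p * A₁) s t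
  refine le_trans ?_ (hC n s t hs1 hst)
  rw [mul_assoc]
  gcongr
  have hi : Integrable (fun ω : Outcome m => min 1 (nominalVolume q p A₁ A₂ s t ω)) (law m) :=
    integrable_comp_degree hm hs1 t fun d => min 1 ((A₁ * (d : ℝ) + A₂) / (t : ℝ))
  have hi1 : Integrable (fun ω : Outcome m => nominalVolume q p A₁ A₂ s t ω) (law m) :=
    integrable_comp_degree hm hs1 t fun d => (A₁ * (d : ℝ) + A₂) / (t : ℝ)
  have hi2 : Integrable (fun ω : Outcome m => nominalVolume q p A₁ A₂ s t ω ^ 2) (law m) :=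
    integrable_comp_degree hm hs1 t fun d => ((A₁ * (d : ℝ) + A₂) / (t : ℝ)) ^ 2
  have h1 : ∫ ω : Outcome m, nominalVolume q p A₁ A₂ s t ω ∂(law m) -
      ∫ ω : Outcome m, nominalVolume q p A₁ A₂ s t ω ^ 2 ∂(law m) ≤
      ∫ ω : Outcome m, min 1 (nominalVolume q p A₁ A₂ s t ω) ∂(law m) := by
    rw [← integral_sub hi1 hi2]
    refine integral_mono (hi1.sub hi2) hi fun ω => ?_
    have hV0 := nominalVolume_nonneg (q := q) (p := p) hA₁.le hA₂.le s t ω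
    refine le_min ?_ ?_ <;> simp only <;>
      nlinarith [sq_nonneg (nominalVolume q p A₁ A₂ s t ω - 1)]
  -- As w ≤ 1/s, the second moment K w² is at most half of the first-moment bound c w once s is
  -- large.
  have h2 : K * typicalVolume (p * A₁) s t ≤ c / 2 := by
    have h3 : K / (c / 2) < s := hs₂.trans_le (by exact_mod_cast (le_max_right _ _).trans hs)
    rw [div_lt_iff₀ (by positivity)] at h3
    calc K * typicalVolume (p * A₁) s t ≤ K * (1 / s) := by
          gcongr; exact typicalVolume_le ha.le hs1 hst
      _ ≤ c / 2 := by
          rw [mul_one_div, div_le_iff₀ hs0]; linarith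
  have h4 := hc s t hss₁ hst
  have h5 := hK s t hs1 hst
  have h6 := mul_le_mul_of_nonneg_right h2 hw0
  have h7 : K * typicalVolume (p * A₁) s t ^ 2 =
    K * typicalVolume (p * A₁) s t * typicalVolume (p * A₁) s t := by ring
  linarith

end LinkProbability

/-! ### Power sums -/

section PowerSums

theorem sum_rpow_neg_le {v : ℝ} (hv0 : 0 ≤ v) (hv : v < 1) (t : ℕ) :
    ∑ s ∈ Finset.Icc 1 t, (s : ℝ) ^ (-v) ≤ (t : ℝ) ^ (1 - v) / (1 - v) := by
  have hv1 : 0 < 1 - v := by linarith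
  induction t with
  | zero => simp [Real.zero_rpow hv1.ne']
  | succ t ih =>
    rw [Finset.sum_Icc_succ_top (by omega)]
    have ht1 : (0 : ℝ) < ((t + 1 : ℕ) : ℝ) := by positivity
    -- Bernoulli at -1/(t+1) bounds the new term (t+1)^{-v} by the increment of t^{1-v}/(1-v).
    have hbern := rpow_one_add_le_one_add_mul_self (s := -(1 / ((t + 1 : ℕ) : ℝ)))
      (by
        have : 1 / ((t + 1 : ℕ) : ℝ) ≤ 1 := by
          rw [div_le_one ht1]; exact_mod_cast Nat.le_add_left 1 t
        linarith) hv1.le (by linarith)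
    have h1 : (t : ℝ) = (1 + -(1 / ((t + 1 : ℕ) : ℝ))) * ((t + 1 : ℕ) : ℝ) := by
      push_cast
      have : (t : ℝ) + 1 ≠ 0 := by positivity
      field_simp
      ring
    have h0 : 0 ≤ 1 + -(1 / ((t + 1 : ℕ) : ℝ)) := by
      have : 1 / ((t + 1 : ℕ) : ℝ) ≤ 1 := by
        rw [div_le_one ht1]; exact_mod_cast Nat.le_add_left 1 t
      linarith
    have h2 : (t : ℝ) ^ (1 - v) ≤ (((t + 1 : ℕ) : ℝ)) ^ (1 - v) -
        (1 - v) * ((t + 1 : ℕ) : ℝ) ^ (-v) := by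
      have h3 : ((t + 1 : ℕ) : ℝ) ^ (-v) = ((t + 1 : ℕ) : ℝ) ^ (1 - v) / ((t + 1 : ℕ) : ℝ) := by
        rw [← Real.rpow_sub_one ht1.ne']; congr 1; ring
      calc (t : ℝ) ^ (1 - v) = (1 + -(1 / ((t + 1 : ℕ) : ℝ))) ^ (1 - v) *
            ((t + 1 : ℕ) : ℝ) ^ (1 - v) := by
            rw [← Real.mul_rpow h0 ht1.le, ← h1]
        _ ≤ (1 + (1 - v) * -(1 / ((t + 1 : ℕ) : ℝ))) * ((t + 1 : ℕ) : ℝ) ^ (1 - v) := by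
            gcongr
        _ = _ := by rw [h3]; ring
    have h4 : (t : ℝ) ^ (1 - v) / (1 - v) + ((t + 1 : ℕ) : ℝ) ^ (-v) ≤
        ((t + 1 : ℕ) : ℝ) ^ (1 - v) / (1 - v) := by
      rw [le_div_iff₀ hv1, add_mul, div_mul_cancel₀ _ hv1.ne']
      linarith
    linarith

theorem sum_rpow_neg_one_le (t : ℕ) :
    ∑ s ∈ Finset.Icc 1 t, (s : ℝ) ^ (-1 : ℝ) ≤ 1 + Real.log t := by
  have h := harmonic_le_one_add_log t
  rw [harmonic_eq_sum_Icc] at h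
  push_cast at h
  simpa only [Real.rpow_neg_one] using h

theorem exists_sum_rpow_neg_le {v : ℝ} (hv : 1 < v) : ∃ B : ℝ, 0 < B ∧ ∀ t : ℕ,
    ∑ s ∈ Finset.Icc 1 t, (s : ℝ) ^ (-v) ≤ B := by
  have hsum : Summable fun i : ℕ => (i : ℝ) ^ (-v) := Real.summable_nat_rpow.2 (by linarith)
  refine ⟨∑' i : ℕ, (i : ℝ) ^ (-v) + 1, ?_, fun t => ?_⟩
  · have : 0 ≤ ∑' i : ℕ, (i : ℝ) ^ (-v) := tsum_nonneg fun i => by positivity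
    linarith
  · have := hsum.sum_le_tsum (Finset.Icc 1 t) fun i _ => by positivity
    linarith

theorem one_add_log_nonneg (n : ℕ) : 0 ≤ 1 + Real.log (n : ℝ) := by
  have := Real.log_natCast_nonneg n
  linarith

theorem typicalVolume_rpow {a : ℝ} {s t : ℕ} (hs : 1 ≤ s) (ht : 1 ≤ t) (η : ℝ) :
    typicalVolume a s t ^ η = (t : ℝ) ^ (-((1 - a) * η)) * (s : ℝ) ^ (-(a * η)) := by
  have hs0 : (0 : ℝ) < s := by exact_mod_cast hs
  have ht0 : (0 : ℝ) < t := by exact_mod_cast ht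
  have h : typicalVolume a s t = (t : ℝ) ^ (-(1 - a)) * (s : ℝ) ^ (-a) := by
    rw [typicalVolume, Real.div_rpow ht0.le hs0.le, Real.rpow_neg hs0.le,
      show -(1 - a) = a - 1 by ring, Real.rpow_sub_one ht0.ne']
    ring
  rw [h, Real.mul_rpow (by positivity) (by positivity), ← Real.rpow_mul ht0.le,
    ← Real.rpow_mul hs0.le]
  congr 2 <;> ring

end PowerSums

/-! ### Upper and lower bounds for the expected number of long edges -/

section Bounds

variable {m : ℕ} {q : ℝ≥0∞} {p A₁ A₂ : ℝ} [Fact (1 ≤ q)]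

/-- With y = w n^α, the integer bounds k = 0 and some k = K ≥ θ together give y^θ: the first
suffices when y ≥ 1, the second when y ≤ 1. Real exponents are needed to make a chosen power sum
critical. -/
theorem exists_law_linkEvent_le_rpow (hm : 0 < m) (hp₀ : 0 < p) (hp₁ : p ≤ 1)
    (hA₁ : 0 < A₁) (hA₂ : 0 < A₂) {α : ℝ} (hα : 0 ≤ α) {θ : ℝ} (hθ : 0 ≤ θ) :
    ∃ C : ℝ, 0 < C ∧ ∀ n s t : ℕ, 1 ≤ n → 1 ≤ s → s ≤ t →
      (law m).real (linkEvent q p A₁ A₂ s t (longThreshold m q α n)) ≤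
        C * (typicalVolume (p * A₁) s t ^ (1 + θ) * (n : ℝ) ^ (α * θ)) := by
  obtain ⟨C₀, hC₀, h₀⟩ := exists_law_linkEvent_le (m := m) (q := q) hm hp₀ hp₁ hA₁ hA₂ hα 0
  obtain ⟨K, hK⟩ := exists_nat_ge θ
  obtain ⟨C₁, hC₁, h₁⟩ := exists_law_linkEvent_le (m := m) (q := q) hm hp₀ hp₁ hA₁ hA₂ hα K
  refine ⟨max C₀ C₁, lt_max_of_lt_left hC₀, fun n s t hn hs hst => ?_⟩
  have hn0 : (0 : ℝ) < n := by exact_mod_cast hn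
  have hs0 : (0 : ℝ) < s := by exact_mod_cast hs
  have ht0 : (0 : ℝ) < t := by exact_mod_cast hs.trans hst
  have hw : 0 < typicalVolume (p * A₁) s t := by unfold typicalVolume; positivity
  set w := typicalVolume (p * A₁) s t with hwd
  have hy : 0 < w * (n : ℝ) ^ α := by positivity
  have hgoal : w ^ (1 + θ) * (n : ℝ) ^ (α * θ) = w * (w * (n : ℝ) ^ α) ^ θ := by
    rw [Real.rpow_add hw, Real.rpow_one, Real.mul_rpow hw.le (by positivity),
      ← Real.rpow_mul hn0.le]
    ring
  rw [hgoal]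
  rcases le_total 1 (w * (n : ℝ) ^ α) with h | h
  · refine (h₀ n s t hn hs hst).trans ?_
    rw [pow_zero]
    gcongr
    · exact le_max_left _ _
    · exact Real.one_le_rpow h hθ
  · refine (h₁ n s t hn hs hst).trans ?_
    gcongr
    · exact le_max_right _ _
    · rw [← Real.rpow_natCast]
      exact Real.rpow_le_rpow_of_exponent_ge hy h hK

theorem expectedLongEdges_le_sum (hm : 0 < m) (α : ℝ) (n : ℕ) :
    expectedLongEdges m q p A₁ A₂ α n ≤ ∑ t ∈ Finset.Icc 1 n, ∑ s ∈ Finset.Icc 1 t,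
      (law m).real (linkEvent q p A₁ A₂ s t (longThreshold m q α n)) := by
  rw [expectedLongEdges_eq_sum hm]
  set f : ℕ → ℝ := fun t => ∑ s ∈ Finset.Icc 1 t,
    (law m).real (linkEvent q p A₁ A₂ s t (longThreshold m q α n)) with hf
  have hf0 : ∀ t, 0 ≤ f t := fun t => Finset.sum_nonneg fun s _ => measureReal_nonneg
  have h0 : f 0 = 0 := by simp [hf]
  calc ∑ t ∈ Finset.range n, f t ≤ ∑ t ∈ Finset.range (n + 1), f t :=
        Finset.sum_le_sum_of_subset_of_nonneg
          (Finset.range_subset_range.2 n.le_succ) fun t _ _ => hf0 t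
    _ = ∑ t ∈ Finset.Icc 1 n, f t := by
        rw [Finset.sum_range_succ', h0, add_zero, Finset.range_eq_Ico, Finset.sum_Ico_add' f 0 n 1]
        rfl

theorem exists_expectedLongEdges_le (hm : 0 < m) (hp₀ : 0 < p) (hp₁ : p ≤ 1)
    (hA₁ : 0 < A₁) (hA₂ : 0 < A₂) {α : ℝ} (hα : 0 ≤ α) {θ : ℝ} (hθ : 0 ≤ θ) :
    ∃ C : ℝ, 0 < C ∧ ∀ n : ℕ, 1 ≤ n → expectedLongEdges m q p A₁ A₂ α n ≤
      C * (n : ℝ) ^ (α * θ) * ∑ t ∈ Finset.Icc 1 n, (t : ℝ) ^ (-((1 - p * A₁) * (1 + θ))) *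
        ∑ s ∈ Finset.Icc 1 t, (s : ℝ) ^ (-(p * A₁ * (1 + θ))) := by
  obtain ⟨C, hC0, hC⟩ := exists_law_linkEvent_le_rpow (m := m) (q := q) hm hp₀ hp₁ hA₁ hA₂ hα hθ
  refine ⟨C, hC0, fun n hn => (expectedLongEdges_le_sum hm α n).trans ?_⟩
  rw [Finset.mul_sum]
  refine Finset.sum_le_sum fun t ht => ?_
  rw [Finset.mul_sum, Finset.mul_sum]
  refine Finset.sum_le_sum fun s hs => ?_
  rw [Finset.mem_Icc] at ht hs
  refine (hC n s t hn hs.1 hs.2).trans (le_of_eq ?_)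
  rw [typicalVolume_rpow hs.1 ht.1]
  ring

theorem exists_expectedLongEdges_le_linear (hm : 0 < m) (hp₀ : 0 < p) (hp₁ : p ≤ 1)
    (hA₁ : 0 < A₁) (hA₂ : 0 < A₂) (ha : p * A₁ < 1) {α : ℝ} (hα : 0 ≤ α) :
    ∃ C : ℝ, 0 < C ∧ ∀ n : ℕ, 1 ≤ n → expectedLongEdges m q p A₁ A₂ α n ≤
      C * ((n : ℝ) ^ (1 : ℝ) * (1 + Real.log n)) := by
  -- θ = 0 ignores the length constraint and counts all edges. The logarithm in the conclusion is
  -- slack, kept so that all upper bounds share one shape.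
  obtain ⟨C, hC0, hC⟩ := exists_expectedLongEdges_le (m := m) (q := q) hm hp₀ hp₁ hA₁ hA₂ hα le_rfl
  have ha0 : 0 < p * A₁ := by positivity
  have ha1 : 0 < 1 - p * A₁ := by linarith
  refine ⟨C * (1 / (1 - p * A₁)), by positivity, fun n hn => (hC n hn).trans ?_⟩
  have hn0 : (0 : ℝ) < n := by exact_mod_cast hn
  have hlog := Real.log_natCast_nonneg n
  simp only [mul_zero, add_zero, mul_one, Real.rpow_zero, Real.rpow_one]
  rw [mul_assoc]
  gcongr
  calc ∑ t ∈ Finset.Icc 1 n, (t : ℝ) ^ (-(1 - p * A₁)) * ∑ s ∈ Finset.Icc 1 t, (s : ℝ) ^ (-(p * A₁))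
      ≤ ∑ t ∈ Finset.Icc 1 n, 1 / (1 - p * A₁) := by
        refine Finset.sum_le_sum fun t ht => ?_
        have ht0 : (0 : ℝ) < t := by exact_mod_cast (Finset.mem_Icc.1 ht).1
        calc _ ≤ (t : ℝ) ^ (-(1 - p * A₁)) * ((t : ℝ) ^ (1 - p * A₁) / (1 - p * A₁)) := by
              gcongr; exact sum_rpow_neg_le ha0.le ha t
          _ = _ := by
              rw [← mul_div_assoc, ← Real.rpow_add ht0, neg_add_cancel, Real.rpow_zero]
    _ = 1 / (1 - p * A₁) * (n * 1) := by simp [mul_comm]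
    _ ≤ _ := by gcongr; linarith

theorem exists_expectedLongEdges_le_of_lt_half (hm : 0 < m) (hp₀ : 0 < p) (hp₁ : p ≤ 1)
    (hA₁ : 0 < A₁) (hA₂ : 0 < A₂) (ha : p * A₁ < 1 / 2) {α : ℝ} (hα : 0 ≤ α) :
    ∃ C : ℝ, 0 < C ∧ ∀ n : ℕ, 1 ≤ n → expectedLongEdges m q p A₁ A₂ α n ≤
      C * ((n : ℝ) ^ α * (1 + Real.log n)) := by
  -- With θ = 1 the inner sum has exponent 2a < 1, and the double sum reduces to the harmonic sum
  -- over t.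
  obtain ⟨C, hC0, hC⟩ := exists_expectedLongEdges_le (m := m) (q := q) hm hp₀ hp₁ hA₁ hA₂ hα
    zero_le_one
  have ha0 : 0 < p * A₁ := by positivity
  have ha1 : 0 < 1 - p * A₁ * (1 + 1) := by linarith
  refine ⟨C * (1 / (1 - p * A₁ * (1 + 1))), by positivity, fun n hn => (hC n hn).trans ?_⟩
  have hn0 : (0 : ℝ) < n := by exact_mod_cast hn
  rw [mul_one α]
  calc _ ≤ C * (n : ℝ) ^ α * ∑ t ∈ Finset.Icc 1 n,
          1 / (1 - p * A₁ * (1 + 1)) * (t : ℝ) ^ (-1 : ℝ) := by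
        refine mul_le_mul_of_nonneg_left (Finset.sum_le_sum fun t ht => ?_) (by positivity)
        have ht0 : (0 : ℝ) < t := by exact_mod_cast (Finset.mem_Icc.1 ht).1
        calc _ ≤ (t : ℝ) ^ (-((1 - p * A₁) * (1 + 1))) *
              ((t : ℝ) ^ (1 - p * A₁ * (1 + 1)) / (1 - p * A₁ * (1 + 1))) := by
              gcongr; exact sum_rpow_neg_le (by positivity) (by linarith) t
          _ = _ := by
              rw [← mul_div_assoc, ← Real.rpow_add ht0, div_mul_eq_mul_div, one_mul]
              congr 2
              ring
    _ ≤ C * (n : ℝ) ^ α * (1 / (1 - p * A₁ * (1 + 1)) * (1 + Real.log n)) := by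
        rw [← Finset.mul_sum]
        gcongr
        exact sum_rpow_neg_one_le n
    _ = _ := by ring

theorem exists_expectedLongEdges_le_of_half_lt (hm : 0 < m) (hp₀ : 0 < p) (hp₁ : p ≤ 1)
    (hA₁ : 0 < A₁) (hA₂ : 0 < A₂) (ha' : 1 / 2 < p * A₁) (ha : p * A₁ < 1) {α : ℝ} (hα : 0 ≤ α) :
    ∃ C : ℝ, 0 < C ∧ ∀ n : ℕ, 1 ≤ n → expectedLongEdges m q p A₁ A₂ α n ≤
      C * ((n : ℝ) ^ (2 - 1 / (p * A₁) + α * ((1 - p * A₁) / (p * A₁))) * (1 + Real.log n)) := by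
  have ha0 : 0 < p * A₁ := by positivity
  set a := p * A₁ with had
  -- This θ makes a(1+θ) = 1, so the inner sum over s is harmonic; a > 1/2 makes the outer exponent
  -- 1/a - 1 less than 1.
  obtain ⟨C, hC0, hC⟩ := exists_expectedLongEdges_le (m := m) (q := q) hm hp₀ hp₁ hA₁ hA₂ hα
    (θ := (1 - a) / a) (div_nonneg (by linarith) ha0.le)
  have hη : 1 + (1 - a) / a = 1 / a := by field_simp; ring
  have hv : a * (1 / a) = 1 := by field_simp
  have hu : (1 - a) * (1 / a) = 1 / a - 1 := by field_simp
  rw [← had, hη, hv, hu] at hC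
  have h2 : 1 / a < 2 := by rw [div_lt_iff₀ ha0]; linarith
  have h3 : 1 ≤ 1 / a := by rw [le_div_iff₀ ha0]; linarith
  have h4 : 0 < 1 - (1 / a - 1) := by linarith
  refine ⟨C * (1 / (1 - (1 / a - 1))), by positivity, fun n hn => (hC n hn).trans ?_⟩
  have hn0 : (0 : ℝ) < n := by exact_mod_cast hn
  have hlogn := one_add_log_nonneg n
  calc _ ≤ C * (n : ℝ) ^ (α * ((1 - a) / a)) * ∑ t ∈ Finset.Icc 1 n,
          (t : ℝ) ^ (-(1 / a - 1)) * (1 + Real.log n) := by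
        gcongr with t ht
        have ht0 : (0 : ℝ) < t := by exact_mod_cast (Finset.mem_Icc.1 ht).1
        refine (sum_rpow_neg_one_le t).trans ?_
        gcongr
        exact (Finset.mem_Icc.1 ht).2
    _ ≤ C * (n : ℝ) ^ (α * ((1 - a) / a)) *
          ((n : ℝ) ^ (1 - (1 / a - 1)) / (1 - (1 / a - 1)) * (1 + Real.log n)) := by
        rw [← Finset.sum_mul]
        gcongr
        exact sum_rpow_neg_le (by linarith) (by linarith) n
    _ = _ := by
        rw [show 2 - 1 / a + α * ((1 - a) / a) = α * ((1 - a) / a) + (1 - (1 / a - 1)) by ring,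
          Real.rpow_add hn0]
        ring

theorem exists_expectedLongEdges_le_of_half_lt_of_le (hm : 0 < m) (hp₀ : 0 < p) (hp₁ : p ≤ 1)
    (hA₁ : 0 < A₁) (hA₂ : 0 < A₂) (ha' : 1 / 2 < p * A₁) (ha : p * A₁ < 1) {α : ℝ} (hα : 0 ≤ α) :
    ∃ C : ℝ, 0 < C ∧ ∀ n : ℕ, 1 ≤ n → expectedLongEdges m q p A₁ A₂ α n ≤
      C * ((n : ℝ) ^ (α * (p * A₁) / (1 - p * A₁)) * (1 + Real.log n)) := by
  have ha0 : 0 < p * A₁ := by positivity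
  set a := p * A₁ with had
  have ha1 : 0 < 1 - a := by linarith
  -- This θ makes (1-a)(1+θ) = 1, so the outer sum over t is harmonic; a > 1/2 makes the inner sum
  -- converge.
  obtain ⟨C, hC0, hC⟩ := exists_expectedLongEdges_le (m := m) (q := q) hm hp₀ hp₁ hA₁ hA₂ hα
    (θ := a / (1 - a)) (by positivity)
  have hη : 1 + a / (1 - a) = 1 / (1 - a) := by field_simp; ring
  have hu : (1 - a) * (1 / (1 - a)) = 1 := by field_simp
  rw [← had, hη, hu, ← mul_div_assoc] at hC
  obtain ⟨B, hB0, hB⟩ := exists_sum_rpow_neg_le (v := a * (1 / (1 - a))) (by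
    rw [mul_one_div, one_lt_div ha1]; linarith)
  refine ⟨C * B, by positivity, fun n hn => (hC n hn).trans ?_⟩
  have hn0 : (0 : ℝ) < n := by exact_mod_cast hn
  calc _ ≤ C * (n : ℝ) ^ (α * a / (1 - a)) * ∑ t ∈ Finset.Icc 1 n, (t : ℝ) ^ (-1 : ℝ) * B := by
        gcongr with t ht
        exact hB t
    _ ≤ C * (n : ℝ) ^ (α * a / (1 - a)) * ((1 + Real.log n) * B) := by
        rw [← Finset.sum_mul]
        gcongr
        exact sum_rpow_neg_one_le n
    _ = _ := by ring

theorem sum_le_expectedLongEdges (hm : 0 < m) (α : ℝ) {n T₀ T₁ : ℕ} (hT₁ : T₁ ≤ n) {S : ℕ → Finset ℕ}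
    (hS : ∀ t ∈ Finset.Ico T₀ T₁, S t ⊆ Finset.Icc 1 t) :
    ∑ t ∈ Finset.Ico T₀ T₁, ∑ s ∈ S t,
      (law m).real (linkEvent q p A₁ A₂ s t (longThreshold m q α n)) ≤
        expectedLongEdges m q p A₁ A₂ α n := by
  rw [expectedLongEdges_eq_sum hm]
  refine (Finset.sum_le_sum fun t ht => Finset.sum_le_sum_of_subset_of_nonneg (hS t ht)
    fun s _ _ => measureReal_nonneg).trans ?_
  refine Finset.sum_le_sum_of_subset_of_nonneg (fun t ht => ?_)
    fun t _ _ => Finset.sum_nonneg fun s _ => measureReal_nonneg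
  rw [Finset.mem_range]
  exact (Finset.mem_Ico.1 ht).2.trans_le hT₁

theorem le_expectedLongEdges_of_rectangle (hm : 0 < m) (α : ℝ) {n T₀ T₁ S₀ S₁ : ℕ} (hT₁ : T₁ ≤ n)
    (hS₀ : 1 ≤ S₀) (hS₁ : S₁ ≤ T₀) {b : ℝ} (hb : ∀ t s, T₀ ≤ t → t < T₁ → S₀ ≤ s → s ≤ S₁ →
      b ≤ (law m).real (linkEvent q p A₁ A₂ s t (longThreshold m q α n))) :
    ((T₁ - T₀ : ℕ) : ℝ) * (((S₁ + 1 - S₀ : ℕ) : ℝ) * b) ≤ expectedLongEdges m q p A₁ A₂ α n := by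
  refine le_trans ?_ (sum_le_expectedLongEdges hm α hT₁ (T₀ := T₀)
    (S := fun _ => Finset.Icc S₀ S₁) fun t ht => Finset.Icc_subset_Icc hS₀
      (hS₁.trans (Finset.mem_Ico.1 ht).1))
  calc _ = ∑ t ∈ Finset.Ico T₀ T₁, ∑ s ∈ Finset.Icc S₀ S₁, b := by simp
    _ ≤ _ := Finset.sum_le_sum fun t ht => Finset.sum_le_sum fun s hs =>
      hb t s (Finset.mem_Ico.1 ht).1 (Finset.mem_Ico.1 ht).2 (Finset.mem_Icc.1 hs).1
        (Finset.mem_Icc.1 hs).2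

theorem eventually_le_const_mul_rpow {γ : ℝ} (hγ : 0 < γ) {ε : ℝ} (hε : 0 < ε) (B : ℝ) :
    ∀ᶠ n : ℕ in atTop, B ≤ ε * (n : ℝ) ^ γ :=
  (((tendsto_rpow_atTop hγ).comp tendsto_natCast_atTop_atTop).const_mul_atTop hε).eventually_ge_atTop B

/-- Young vertices contribute at least `n ^ γ` long edges, `γ = min α 1`. -/
theorem exists_le_expectedLongEdges (hm : 0 < m) (hp₀ : 0 < p) (hp₁ : p ≤ 1)
    (hA₁ : 0 < A₁) (hA₂ : 0 < A₂) {α γ : ℝ} (hγ₀ : 0 < γ) (hγα : γ ≤ α) (hγ₁ : γ ≤ 1) :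
    ∃ c : ℝ, 0 < c ∧ ∀ᶠ n : ℕ in atTop, c * (n : ℝ) ^ γ ≤ expectedLongEdges m q p A₁ A₂ α n := by
  obtain ⟨C, hC0, hC⟩ := exists_le_law_linkEvent_of_time (m := m) (q := q) hm hp₀ hp₁ hA₁ hA₂ α
  set B := min 1 A₂ with hB
  have hB0 : 0 < B := lt_min one_pos hA₂
  -- For t ≤ εn^γ ≤ εn^α the loss C n^{-α} is at most half of pB/t. Each such t then has t targets
  -- of probability at least pB/(2t), hence a constant expected number of long links.
  set ε := min 1 (p * B / (2 * C)) with hεd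
  have hε0 : 0 < ε := lt_min one_pos (by positivity)
  have hεC : C * ε ≤ p * B / 2 := by
    calc C * ε ≤ C * (p * B / (2 * C)) := by gcongr; exact min_le_right _ _
      _ = _ := by field_simp
  refine ⟨p * B / 2 * (ε / 2), by positivity, ?_⟩
  filter_upwards [eventually_le_const_mul_rpow hγ₀ (half_pos hε0) 2, eventually_ge_atTop 1]
    with n hn hn1
  have hn0 : (0 : ℝ) < n := by exact_mod_cast hn1
  have hn1' : (1 : ℝ) ≤ n := by exact_mod_cast hn1
  have hεn : 0 ≤ ε * (n : ℝ) ^ γ := by positivity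
  set T := ⌊ε * (n : ℝ) ^ γ⌋₊ with hT
  have hTle : (T : ℝ) ≤ ε * (n : ℝ) ^ γ := Nat.floor_le hεn
  have hTn : T ≤ n := by
    have : (T : ℝ) ≤ n := by
      calc (T : ℝ) ≤ ε * (n : ℝ) ^ γ := hTle
        _ ≤ 1 * (n : ℝ) ^ (1 : ℝ) := by
          gcongr
          exact min_le_left _ _
        _ = n := by rw [one_mul, Real.rpow_one]
    exact_mod_cast this
  refine le_trans ?_ (sum_le_expectedLongEdges hm α hTn (T₀ := 1)
    (S := fun t => Finset.Icc 1 t) fun t _ => subset_rfl)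
  have hinner : ∀ t ∈ Finset.Ico 1 T, p * B / 2 ≤ ∑ s ∈ Finset.Icc 1 t,
      (law m).real (linkEvent q p A₁ A₂ s t (longThreshold m q α n)) := by
    intro t ht
    rw [Finset.mem_Ico] at ht
    have ht0 : (0 : ℝ) < t := by exact_mod_cast ht.1
    have ht1 : (1 : ℝ) ≤ t := by exact_mod_cast ht.1
    have hmin : B / t ≤ min 1 (A₂ / t) := by
      refine le_min ?_ ?_
      · rw [div_le_one ht0]; exact (min_le_left _ _).trans ht1
      · gcongr; exact min_le_right _ _
    have hx : C * (n : ℝ) ^ (-α) ≤ p * B / 2 / t := by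
      rw [le_div_iff₀ ht0]
      have htT : (t : ℝ) ≤ ε * (n : ℝ) ^ α := by
        calc (t : ℝ) ≤ T := by exact_mod_cast ht.2.le
          _ ≤ ε * (n : ℝ) ^ γ := hTle
          _ ≤ _ := by gcongr
      calc C * (n : ℝ) ^ (-α) * t ≤ C * (n : ℝ) ^ (-α) * (ε * (n : ℝ) ^ α) := by gcongr
        _ = C * ε * ((n : ℝ) ^ (-α) * (n : ℝ) ^ α) := by ring
        _ = C * ε := by rw [← Real.rpow_add hn0, neg_add_cancel, Real.rpow_zero, mul_one]
        _ ≤ _ := hεC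
    have hlow : ∀ s ∈ Finset.Icc 1 t, p * B / 2 / t ≤
        (law m).real (linkEvent q p A₁ A₂ s t (longThreshold m q α n)) := by
      intro s hs
      refine le_trans ?_ (hC n s t (Finset.mem_Icc.1 hs).1 (Finset.mem_Icc.1 hs).2)
      have h1 := mul_le_mul_of_nonneg_left hmin hp₀.le
      have h2 : p * (B / t) = p * B / 2 / t + p * B / 2 / t := by ring
      linarith
    calc p * B / 2 = ∑ s ∈ Finset.Icc 1 t, p * B / 2 / t := by
          simp; field_simp
      _ ≤ _ := Finset.sum_le_sum hlow
  calc p * B / 2 * (ε / 2) * (n : ℝ) ^ γ = (ε / 2 * (n : ℝ) ^ γ) * (p * B / 2) := by ring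
    _ ≤ ((T - 1 : ℕ) : ℝ) * (p * B / 2) := by
        gcongr
        have h1 := Nat.lt_floor_add_one (ε * (n : ℝ) ^ γ)
        rw [← hT] at h1
        have h2 : (T : ℝ) - 1 ≤ ((T - 1 : ℕ) : ℝ) := by
          rw [sub_le_iff_le_add]; exact_mod_cast (le_tsub_add : T ≤ T - 1 + 1)
        linarith
    _ = ∑ t ∈ Finset.Ico 1 T, p * B / 2 := by simp
    _ ≤ _ := Finset.sum_le_sum hinner

/-- Old vertices up to time `ε n ^ δ` contribute long edges in the last half of the process. -/
theorem exists_le_expectedLongEdges_of_lt (hm : 0 < m) (hp₀ : 0 < p) (hp₁ : p ≤ 1)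
    (hA₁ : 0 < A₁) (hA₂ : 0 < A₂) (ha : p * A₁ < 1) {α : ℝ} (hα : 1 - p * A₁ < α) (hα₁ : α < 1) :
    ∃ c : ℝ, 0 < c ∧ ∀ᶠ n : ℕ in atTop,
      c * (n : ℝ) ^ (2 - 1 / (p * A₁) + α * ((1 - p * A₁) / (p * A₁))) ≤
        expectedLongEdges m q p A₁ A₂ α n := by
  obtain ⟨c, C, hc0, hC0, s₀, hs₀, h⟩ := exists_le_law_linkEvent_of_typicalVolume (m := m) (q := q)
    hm hp₀ hp₁ hA₁ hA₂ ha α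
  have ha0 : 0 < p * A₁ := by positivity
  set a := p * A₁ with had
  -- At s = n^δ the typical volume w(s,n) equals n^{-α}; the count is n · n^δ pairs, each of weight
  -- n^{-α}.
  set δ := (α - 1 + a) / a with hδ
  have hδ0 : 0 < δ := div_pos (by linarith) ha0
  have hδ1 : δ ≤ 1 := by rw [hδ, div_le_one ha0]; linarith
  -- Restricting to s ≤ εn^δ raises w by ε^{-a}, enough to absorb the loss C n^{-α}; ε ≤ 1/2 keeps
  -- these vertices older than time n/2.
  obtain ⟨ε, hε0, hε1, hεC⟩ : ∃ ε : ℝ, 0 < ε ∧ ε ≤ 1 / 2 ∧ C ≤ c / 2 * ε ^ (-a) := by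
    have hlim := (tendsto_rpow_neg_nhdsGT_zero (neg_neg_of_pos ha0)).const_mul_atTop (half_pos hc0)
    obtain ⟨ε, h1, h2, h3⟩ := ((hlim.eventually_ge_atTop C).and
      ((Ioc_mem_nhdsGT (show (0 : ℝ) < 1 / 2 by norm_num)))).exists
    exact ⟨ε, h2, h3, h1⟩
  refine ⟨1 / 4 * (ε / 2 * (c / 2 * ε ^ (-a))), by positivity, ?_⟩
  filter_upwards [eventually_le_const_mul_rpow hδ0 (half_pos hε0) (s₀ : ℝ), eventually_ge_atTop 4]
    with n hn hn4
  have hn0 : (0 : ℝ) < n := by exact_mod_cast (by omega : 0 < n)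
  have hn1 : (1 : ℝ) ≤ n := by exact_mod_cast (by omega : 1 ≤ n)
  set S := ⌊ε * (n : ℝ) ^ δ⌋₊ with hS
  have hSle : (S : ℝ) ≤ ε * (n : ℝ) ^ δ := Nat.floor_le (by positivity)
  have hST : S ≤ n / 2 := by
    rw [Nat.le_div_iff_mul_le two_pos]
    have : (S : ℝ) * 2 ≤ n := by
      have h1 : ε * (n : ℝ) ^ δ ≤ 1 / 2 * (n : ℝ) ^ (1 : ℝ) := by gcongr
      rw [Real.rpow_one] at h1
      linarith
    exact_mod_cast this
  have hrect := le_expectedLongEdges_of_rectangle (q := q) (p := p) (A₁ := A₁) (A₂ := A₂) hm α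
    (n := n) (T₀ := n / 2) (T₁ := n) (S₀ := s₀) (S₁ := S) (b := c / 2 * (ε ^ (-a) * (n : ℝ) ^ (-α)))
    le_rfl hs₀ hST ?_
  · refine le_trans ?_ hrect
    have h1 : 1 / 4 * (n : ℝ) ≤ ((n - n / 2 : ℕ) : ℝ) := by
      have : n ≤ 4 * (n - n / 2) := by omega
      have h2 : (n : ℝ) ≤ 4 * ((n - n / 2 : ℕ) : ℝ) := by exact_mod_cast this
      linarith
    have h2 : ε / 2 * (n : ℝ) ^ δ ≤ ((S + 1 - s₀ : ℕ) : ℝ) := by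
      have h3 := Nat.lt_floor_add_one (ε * (n : ℝ) ^ δ)
      rw [← hS] at h3
      have h4 : (S : ℝ) + 1 - s₀ ≤ ((S + 1 - s₀ : ℕ) : ℝ) := by
        rw [sub_le_iff_le_add]; exact_mod_cast le_tsub_add
      linarith
    have hexp : 2 - 1 / a + α * ((1 - a) / a) = 1 + δ + -α := by
      rw [hδ]; field_simp; ring
    rw [hexp, Real.rpow_add hn0, Real.rpow_add hn0, Real.rpow_one]
    calc _ = 1 / 4 * (n : ℝ) * (ε / 2 * (n : ℝ) ^ δ * (c / 2 * (ε ^ (-a) * (n : ℝ) ^ (-α)))) := by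
          ring
      _ ≤ _ := by gcongr
  · intro t s ht htn hs hsS
    have hs1 : 1 ≤ s := hs₀.trans hs
    have hst : s ≤ t := hsS.trans (hST.trans ht)
    have hs0 : (0 : ℝ) < s := by exact_mod_cast hs1
    have ht0 : (0 : ℝ) < t := by exact_mod_cast hs1.trans hst
    refine le_trans ?_ (h n s t hs hst)
    have hw : ε ^ (-a) * (n : ℝ) ^ (-α) ≤ typicalVolume a s t := by
      have h1 := typicalVolume_rpow (a := a) hs1 (hs1.trans hst) 1
      rw [Real.rpow_one, mul_one, mul_one] at h1
      rw [h1]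
      calc ε ^ (-a) * (n : ℝ) ^ (-α) = (n : ℝ) ^ (-(1 - a)) * (ε * (n : ℝ) ^ δ) ^ (-a) := by
            rw [Real.mul_rpow hε0.le (by positivity), ← Real.rpow_mul hn0.le, mul_left_comm,
              ← Real.rpow_add hn0]
            congr 2
            rw [hδ]; field_simp; ring
        _ ≤ (t : ℝ) ^ (-(1 - a)) * (s : ℝ) ^ (-a) := by
            gcongr ?_ * ?_
            · exact Real.rpow_le_rpow_of_nonpos ht0 (by exact_mod_cast htn.le) (by linarith)
            · refine Real.rpow_le_rpow_of_nonpos hs0 (le_trans ?_ hSle) (by linarith)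
              exact_mod_cast hsS
    have h1 : C * (n : ℝ) ^ (-α) ≤ c / 2 * (ε ^ (-a) * (n : ℝ) ^ (-α)) := by
      rw [← mul_assoc]; gcongr
    have h2 := mul_le_mul_of_nonneg_left hw hc0.le
    linarith

/-- A single old vertex contributes long edges up to time `ε n ^ (α / (1 - p A₁))`. -/
theorem exists_le_expectedLongEdges_of_le (hm : 0 < m) (hp₀ : 0 < p) (hp₁ : p ≤ 1)
    (hA₁ : 0 < A₁) (hA₂ : 0 < A₂) (ha : p * A₁ < 1) {α : ℝ} (hα₀ : 0 < α) (hα : α ≤ 1 - p * A₁) :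
    ∃ c : ℝ, 0 < c ∧ ∀ᶠ n : ℕ in atTop,
      c * (n : ℝ) ^ (α * (p * A₁) / (1 - p * A₁)) ≤ expectedLongEdges m q p A₁ A₂ α n := by
  obtain ⟨c, C, hc0, hC0, s₀, hs₀, h⟩ := exists_le_law_linkEvent_of_typicalVolume (m := m) (q := q)
    hm hp₀ hp₁ hA₁ hA₂ ha α
  have ha0 : 0 < p * A₁ := by positivity
  set a := p * A₁ with had
  have ha1 : 0 < 1 - a := by linarith
  have hs0 : (0 : ℝ) < s₀ := by exact_mod_cast hs₀
  -- At t = n^τ the typical volume of a vertex of bounded age index s₀ falls to order n^{-α}; τ ≤ 1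
  -- is exactly the range of α considered.
  set τ := α / (1 - a) with hτ
  have hτ0 : 0 < τ := by positivity
  have hτ1 : τ ≤ 1 := by rw [hτ, div_le_one ha1]; exact hα
  have hcs : 0 < c / 2 * (s₀ : ℝ) ^ (-a) := by positivity
  obtain ⟨ε, hε0, hε1, hεC⟩ : ∃ ε : ℝ, 0 < ε ∧ ε ≤ 1 ∧
      C ≤ c / 2 * (s₀ : ℝ) ^ (-a) * ε ^ (-(1 - a)) := by
    have hlim := (tendsto_rpow_neg_nhdsGT_zero (neg_neg_of_pos ha1)).const_mul_atTop hcs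
    obtain ⟨ε, h1, h2, h3⟩ := ((hlim.eventually_ge_atTop C).and
      ((Ioc_mem_nhdsGT (show (0 : ℝ) < 1 by norm_num)))).exists
    exact ⟨ε, h2, h3, h1⟩
  refine ⟨ε / 2 * (c / 2 * (s₀ : ℝ) ^ (-a) * ε ^ (-(1 - a))), by positivity, ?_⟩
  filter_upwards [eventually_le_const_mul_rpow hτ0 (half_pos hε0) ((s₀ : ℝ) + 1),
    eventually_ge_atTop 1] with n hn hn1
  have hn0 : (0 : ℝ) < n := by exact_mod_cast hn1
  have hn1' : (1 : ℝ) ≤ n := by exact_mod_cast hn1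
  set T := ⌊ε * (n : ℝ) ^ τ⌋₊ with hT
  have hTle : (T : ℝ) ≤ ε * (n : ℝ) ^ τ := Nat.floor_le (by positivity)
  have hTn : T ≤ n := by
    have h1 : ε * (n : ℝ) ^ τ ≤ 1 * (n : ℝ) ^ (1 : ℝ) := by gcongr
    rw [Real.rpow_one, one_mul] at h1
    exact_mod_cast hTle.trans h1
  have hrect := le_expectedLongEdges_of_rectangle (q := q) (p := p) (A₁ := A₁) (A₂ := A₂) hm α
    (n := n) (T₀ := s₀) (T₁ := T) (S₀ := s₀) (S₁ := s₀)
    (b := c / 2 * (s₀ : ℝ) ^ (-a) * ε ^ (-(1 - a)) * (n : ℝ) ^ (-α)) hTn hs₀ le_rfl ?_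
  · refine le_trans ?_ hrect
    have h2 : ε / 2 * (n : ℝ) ^ τ ≤ ((T - s₀ : ℕ) : ℝ) := by
      have h3 := Nat.lt_floor_add_one (ε * (n : ℝ) ^ τ)
      rw [← hT] at h3
      have h4 : (T : ℝ) - s₀ ≤ ((T - s₀ : ℕ) : ℝ) := by
        rw [sub_le_iff_le_add]; exact_mod_cast le_tsub_add
      linarith
    have hexp : α * a / (1 - a) = τ + -α := by
      rw [hτ]; field_simp; ring
    rw [hexp, Real.rpow_add hn0, Nat.add_sub_cancel_left, Nat.cast_one, one_mul]
    calc _ = ε / 2 * (n : ℝ) ^ τ *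
          (c / 2 * (s₀ : ℝ) ^ (-a) * ε ^ (-(1 - a)) * (n : ℝ) ^ (-α)) := by ring
      _ ≤ _ := by gcongr
  · intro t s ht htT hs hsS
    obtain rfl : s = s₀ := le_antisymm hsS hs
    have ht0 : (0 : ℝ) < t := by exact_mod_cast hs₀.trans ht
    refine le_trans ?_ (h n s t le_rfl ht)
    have hw : (s : ℝ) ^ (-a) * (ε ^ (-(1 - a)) * (n : ℝ) ^ (-α)) ≤ typicalVolume a s t := by
      have h1 := typicalVolume_rpow (a := a) hs₀ (hs₀.trans ht) 1
      rw [Real.rpow_one, mul_one, mul_one] at h1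
      rw [h1, mul_comm]
      gcongr
      calc ε ^ (-(1 - a)) * (n : ℝ) ^ (-α) = (ε * (n : ℝ) ^ τ) ^ (-(1 - a)) := by
            rw [Real.mul_rpow hε0.le (by positivity), ← Real.rpow_mul hn0.le]
            congr 2
            rw [hτ]; field_simp
        _ ≤ (t : ℝ) ^ (-(1 - a)) := by
            refine Real.rpow_le_rpow_of_nonpos ht0 (le_trans ?_ hTle) (by linarith)
            exact_mod_cast htT.le
    have h1 : C * (n : ℝ) ^ (-α) ≤
        c / 2 * (s : ℝ) ^ (-a) * ε ^ (-(1 - a)) * (n : ℝ) ^ (-α) := by gcongr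
    have h2 := mul_le_mul_of_nonneg_left hw hc0.le
    linarith

/-- At α = 0 the threshold does not depend on n, so the long edges of a smaller graph remain long.
-/
theorem expectedLongEdges_zero_mono (hm : 0 < m) {N n : ℕ} (h : N ≤ n) :
    expectedLongEdges m q p A₁ A₂ 0 N ≤ expectedLongEdges m q p A₁ A₂ 0 n := by
  have hr : longThreshold m q 0 N = longThreshold m q 0 n := by simp [longThreshold]
  rw [expectedLongEdges_eq_sum hm, expectedLongEdges_eq_sum hm, hr]
  exact Finset.sum_le_sum_of_subset_of_nonneg (Finset.range_subset_range.2 h)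
    fun t _ _ => Finset.sum_nonneg fun s _ => measureReal_nonneg

theorem exists_le_expectedLongEdges_zero (hm : 0 < m)
    (h : ∃ n : ℕ, 0 < expectedLongEdges m q p A₁ A₂ 0 n) :
    ∃ c : ℝ, 0 < c ∧ ∀ᶠ n : ℕ in atTop,
      c * (n : ℝ) ^ (0 : ℝ) ≤ expectedLongEdges m q p A₁ A₂ 0 n := by
  obtain ⟨N, hN⟩ := h
  refine ⟨_, hN, ?_⟩
  filter_upwards [eventually_ge_atTop N] with n hn
  rw [Real.rpow_zero, mul_one]
  exact expectedLongEdges_zero_mono hm hn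

end Bounds

/-! ### From two-sided bounds to the exponent -/

section Exponent

theorem tendsto_log_div_log {E : ℕ → ℝ} {γ : ℝ}
    (hlow : ∃ c : ℝ, 0 < c ∧ ∀ᶠ n : ℕ in atTop, c * (n : ℝ) ^ γ ≤ E n)
    (hup : ∃ C : ℝ, 0 < C ∧ ∀ n : ℕ, 1 ≤ n → E n ≤ C * ((n : ℝ) ^ γ * (1 + Real.log n))) :
    (∀ᶠ n : ℕ in atTop, 0 < E n) ∧
      Tendsto (fun n : ℕ => Real.log (E n) / Real.log (n : ℝ)) atTop (𝓝 γ) := by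
  obtain ⟨c, hc0, hc⟩ := hlow
  obtain ⟨C, hC0, hC⟩ := hup
  have hlog : Tendsto (fun n : ℕ => Real.log (n : ℝ)) atTop atTop :=
    Real.tendsto_log_atTop.comp tendsto_natCast_atTop_atTop
  have hlim1 : Tendsto (fun n : ℕ => Real.log c / Real.log (n : ℝ) + γ) atTop (𝓝 γ) := by
    simpa using (hlog.const_div_atTop (Real.log c)).add_const γ
  have hll : Tendsto (fun n : ℕ => Real.log (1 + Real.log (n : ℝ)) / Real.log (n : ℝ))
      atTop (𝓝 0) := by
    -- This is log x / (x - 1) → 0, evaluated at x = 1 + log n.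
    have h1 := Real.tendsto_pow_log_div_mul_add_atTop 1 (-1) 1 one_ne_zero
    refine (h1.comp (tendsto_atTop_add_const_left atTop 1 hlog)).congr fun n => ?_
    simp
  have hlim2 : Tendsto (fun n : ℕ => Real.log C / Real.log (n : ℝ) +
      (γ + Real.log (1 + Real.log (n : ℝ)) / Real.log (n : ℝ))) atTop (𝓝 γ) := by
    simpa using (hlog.const_div_atTop (Real.log C)).add (hll.const_add γ)
  refine ⟨?_, tendsto_of_tendsto_of_tendsto_of_le_of_le' hlim1 hlim2 ?_ ?_⟩
  · filter_upwards [hc, eventually_ge_atTop 1] with n hn hn1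
    have hn0 : (0 : ℝ) < n := by exact_mod_cast hn1
    exact lt_of_lt_of_le (by positivity) hn
  · filter_upwards [hc, eventually_ge_atTop 2] with n hn hn2
    have hn0 : (0 : ℝ) < n := by exact_mod_cast (by omega : 0 < n)
    have hl : 0 < Real.log (n : ℝ) := Real.log_pos (by exact_mod_cast hn2)
    have h1 := Real.log_le_log (by positivity) hn
    rw [Real.log_mul hc0.ne' (by positivity), Real.log_rpow hn0] at h1
    rw [le_div_iff₀ hl, add_mul, div_mul_cancel₀ _ hl.ne']
    exact h1
  · filter_upwards [hc, eventually_ge_atTop 2] with n hn hn2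
    have hn0 : (0 : ℝ) < n := by exact_mod_cast (by omega : 0 < n)
    have hl : 0 < Real.log (n : ℝ) := Real.log_pos (by exact_mod_cast hn2)
    have hE : 0 < E n := lt_of_lt_of_le (by positivity) hn
    have h1 := Real.log_le_log hE (hC n (by omega))
    rw [Real.log_mul hC0.ne' (by positivity), Real.log_mul (by positivity) (by positivity),
      Real.log_rpow hn0] at h1
    rw [div_le_iff₀ hl, add_mul, add_mul, div_mul_cancel₀ _ hl.ne', div_mul_cancel₀ _ hl.ne']
    exact h1

end Exponent

end SPA

theorem theorem4p2
    (m : ℕ) (hm : 0 < m) (q : ℝ≥0∞) (hq : 1 ≤ q)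
    (p A₁ A₂ : ℝ) (hp₀ : 0 < p) (hp₁ : p ≤ 1) (hA₁ : 0 < A₁) (hA₂ : 0 < A₂)
    (α : ℝ) (hα : 0 ≤ α)
    -- only for `α = 0`: the logarithm must make sense for some size of the graph
    (hα₀ : α = 0 → ∃ n : ℕ, 0 < SPA.expectedLongEdges m q p A₁ A₂ 0 n) :
    (1 / 2 < p * A₁ → p * A₁ < 1 →
      (∀ᶠ n : ℕ in atTop, 0 < SPA.expectedLongEdges m q p A₁ A₂ α n) ∧
      (1 ≤ α →
        Tendsto (fun n : ℕ =>
          Real.log (SPA.expectedLongEdges m q p A₁ A₂ α n) / Real.log (n : ℝ)) atTop (𝓝 1)) ∧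
      (1 - p * A₁ < α → α < 1 →
        Tendsto (fun n : ℕ =>
          Real.log (SPA.expectedLongEdges m q p A₁ A₂ α n) / Real.log (n : ℝ)) atTop
          (𝓝 (2 - 1 / (p * A₁) + α * ((1 - p * A₁) / (p * A₁))))) ∧
      (α ≤ 1 - p * A₁ →
        Tendsto (fun n : ℕ =>
          Real.log (SPA.expectedLongEdges m q p A₁ A₂ α n) / Real.log (n : ℝ)) atTop
          (𝓝 (α * (p * A₁) / (1 - p * A₁))))) ∧
    (p * A₁ < 1 / 2 →
      (∀ᶠ n : ℕ in atTop, 0 < SPA.expectedLongEdges m q p A₁ A₂ α n) ∧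
      (1 ≤ α →
        Tendsto (fun n : ℕ =>
          Real.log (SPA.expectedLongEdges m q p A₁ A₂ α n) / Real.log (n : ℝ)) atTop (𝓝 1)) ∧
      (α < 1 →
        Tendsto (fun n : ℕ =>
          Real.log (SPA.expectedLongEdges m q p A₁ A₂ α n) / Real.log (n : ℝ)) atTop (𝓝 α))) := by
  have : Fact (1 ≤ q) := ⟨hq⟩
  have hlinear : p * A₁ < 1 → 1 ≤ α → _ := fun ha h1 =>
    SPA.tendsto_log_div_log
      (SPA.exists_le_expectedLongEdges (m := m) (q := q) hm hp₀ hp₁ hA₁ hA₂ one_pos h1 le_rfl)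
      (SPA.exists_expectedLongEdges_le_linear hm hp₀ hp₁ hA₁ hA₂ ha hα)
  refine ⟨fun ha' ha => ?_, fun ha => ?_⟩
  · have hmid : 1 - p * A₁ < α → α < 1 → _ := fun h1 h2 =>
      SPA.tendsto_log_div_log
        (SPA.exists_le_expectedLongEdges_of_lt (m := m) (q := q) hm hp₀ hp₁ hA₁ hA₂ ha h1 h2)
        (SPA.exists_expectedLongEdges_le_of_half_lt hm hp₀ hp₁ hA₁ hA₂ ha' ha hα)
    have hsmall : α ≤ 1 - p * A₁ → _ := fun h1 =>
      SPA.tendsto_log_div_log (E := SPA.expectedLongEdges m q p A₁ A₂ α)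
        (γ := α * (p * A₁) / (1 - p * A₁)) (by
          -- At α = 0 the exponent is 0, so a positive constant lower bound suffices, and this is
          -- the only use of `hα₀` in this range.
          rcases hα.eq_or_lt with h | h
          · subst h
            rw [zero_mul, zero_div]
            exact SPA.exists_le_expectedLongEdges_zero hm (hα₀ rfl)
          · exact SPA.exists_le_expectedLongEdges_of_le hm hp₀ hp₁ hA₁ hA₂ ha h h1)
        (SPA.exists_expectedLongEdges_le_of_half_lt_of_le hm hp₀ hp₁ hA₁ hA₂ ha' ha hα)
    refine ⟨?_, fun h => (hlinear ha h).2, fun h1 h2 => (hmid h1 h2).2, fun h => (hsmall h).2⟩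
    rcases le_or_gt 1 α with h | h
    · exact (hlinear ha h).1
    · rcases le_or_gt α (1 - p * A₁) with h' | h'
      · exact (hsmall h').1
      · exact (hmid h' h).1
  · have ha1 : p * A₁ < 1 := by linarith
    have hsmall : α < 1 → _ := fun h1 =>
      SPA.tendsto_log_div_log (E := SPA.expectedLongEdges m q p A₁ A₂ α) (γ := α) (by
          rcases hα.eq_or_lt with h | h
          · subst h
            exact SPA.exists_le_expectedLongEdges_zero hm (hα₀ rfl)
          · exact SPA.exists_le_expectedLongEdges hm hp₀ hp₁ hA₁ hA₂ h le_rfl h1.le)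
        (SPA.exists_expectedLongEdges_le_of_lt_half hm hp₀ hp₁ hA₁ hA₂ ha hα)
    refine ⟨?_, fun h => (hlinear ha1 h).2, fun h => (hsmall h).2⟩
    rcases le_or_gt 1 α with h | h
    · exact (hlinear ha1 h).1
    · exact (hsmall h).1
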